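/- **Driving process.** Let $0=t_0<t_1<\cdots$ and $l\ge 1$ be such that $A_j=[t_{j-1},t_j)$ satisfies $|A_{j+l}|=|A_j|$ for all $j\ge1$, and put $\tau=\sum_{j=1}^l|A_j|=t_l$ and $\mathfrak D_j=\bigcup_{k\ge0}A_{j+kl}$. Let $\lambda\ge0$ be a locally integrable $\tau$-periodic function on $[0,\infty)$, and let $N$ be a Poisson process with intensity $\lambda$ (independent increments, $N(t)-N(s)$ Poisson with mean $\int_s^t\lambda(u)\,du$) and arrival times $\Upsilon_1\le\Upsilon_2\le\cdots$. Let $Z_n^j$ ($n\ge1$, $1\le j\le l$) be independent random variables, independent of $N$, with $Z_n^j\sim F_j$ and $\int z^2F_j(dz)<\infty$. Let $D$ be a deterministic, continuous, $\tau$-periodic function on $[0,\infty)$ of locally bounded variation with $D_0=0$. Put $$S_t=D_t+\sum_{n=1}^{N(t)}Z_n,\qquad Z_n=\sum_{j=1}^lZ_n^j\mathbf 1_{\{\Upsilon_n\in\mathfrak D_j\}} .$$ **Volatility.** Let $q\ge p\ge1$, $\alpha_0>0$, $\alpha_1,\dots,\alpha_p,\beta_1,\dots,\beta_q\in\mathbb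 R$ with $\alpha_p\ne0$, $\beta_q\ne0$, and $\alpha_{p+1}=\cdots=\alpha_q=0$. Let $\mathbf a=(\alpha_1,\dots,\alpha_q)'$, $\mathbf e=(0,\dots,0,1)'\in\mathbb R^q$, and let $B$ be the $q\times q$ matrix with ones on the superdiagonal, last row $(-\beta_q,\dots,-\beta_1)$, and zeros elsewhere. Let $\mathbf Y$ be a càdlàg solution of $$d\mathbf Y_t=B\mathbf Y_{t-}\,dt+\mathbf e(\alpha_0+\mathbf a'\mathbf Y_{t-})\,d[S,S]_t$$ with $\mathbf Y_0$ independent of $S$, and let $V_t=\alpha_0+\mathbf a'\mathbf Y_{t-}$ for $t>0$, $V_0=\alpha_0+\mathbf a'\mathbf Y_0$. (Here $\sqrt x$ is read as $0$ for $x<0$, so that no assumption on the sign of $V$ is needed; when $V\ge 0$ it is the usual square root.) **Corollary 3.2.** Suppose that $V$ is strictly periodically stationary with period $\tau$: for all $s_1,\dots,s_n\ge0$, Borel sets $J_1,\dots,J_n\subseteq\mathbb R$ and $k\in\mathbb N$, $$P(V_{s_1}\in J_1,\dots,V_{s_n}\in J_n)=P(V_{s_1+k\tau}\in J_1,\dots,V_{s_n+k\tau}\in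 J_n).$$ Fix $r>0$ and let $G^{(r)}_t=\int_t^{t+r}\sqrt{V_s}\,dS_s$ (integral over $(t,t+r]$). Then for all $t,h\ge0$ and $k\in\mathbb N$: 1. $G^{(r)}_t$ is integrable (respectively square-integrable) if and only if $G^{(r)}_{t+k\tau}$ is, and, when the means exist, $E\,G^{(r)}_t=E\,G^{(r)}_{t+k\tau}$; 2. $G^{(r)}_tG^{(r)}_{t+h}$ is integrable if and only if $G^{(r)}_{t+k\tau}G^{(r)}_{t+h+k\tau}$ is, and, when the covariances exist, $$\operatorname{cov}(G^{(r)}_t,G^{(r)}_{t+h})=\operatorname{cov}(G^{(r)}_{t+k\tau},G^{(r)}_{t+h+k\tau}).$$ In particular, if all $G^{(r)}_t$, $t\ge0$, are square-integrable, then $(G^{(r)}_t)_{t\ge0}$ is a periodically correlated process with period $\tau$ (a square-integrable process whose mean and covariance functions are invariant under the shifts by $k\tau$). -/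

import Mathlib

open MeasureTheory ProbabilityTheory
open scoped NNReal Topology

namespace SSCOGARCH

noncomputable section

/-! ### Pathwise calculus on `[0, ∞)` -/

/-- A right-continuous path with left limits. -/
structure IsCadlag {E : Type*} [TopologicalSpace E] (x : ℝ≥0 → E) : Prop where
  right_continuous : ∀ t, ContinuousWithinAt x (Set.Ici t) t
  left_limits : ∀ t, ∃ y, Filter.Tendsto x (𝓝[<] t) (𝓝 y)

open Classical in
/-- The Lebesgue–Stieltjes integral `∫_{(a, b]} f(u) dg(u)` of a function `f` on `[0, ∞)` against a
right-continuous function `g` whose restriction to `[0, b]` has bounded variation. It is the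
integral of `f` against the signed measure of the stopped function `u ↦ g (min u b)`, which charges
an interval `(c, d] ⊆ [0, b]` with `g d - g c`. (Default value `0` if `g` has infinite variation on
`[0, b]`.) For an integrator with paths of finite variation and a left-continuous adapted integrand
this is the stochastic integral. -/
def stieltjesIntegral (f g : ℝ≥0 → ℝ) (a b : ℝ≥0) : ℝ :=
  if h : BoundedVariationOn (fun u => g (min u b)) Set.univ then
    ∫ᵛ u in Set.Ioc a b, f u ∂•h.vectorMeasure
  else 0

/-- The quadratic variation `[x, x]_t = x_t² - x_0² - 2 ∫_{(0, t]} x_{u-} dx_u` of a path of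
locally finite variation. -/
def quadraticVariation (x : ℝ≥0 → ℝ) (t : ℝ≥0) : ℝ :=
  x t ^ 2 - x 0 ^ 2 - 2 * stieltjesIntegral (Function.leftLim x) x 0 t

/-! ### The driving process -/

/-- A Poisson process on `[0, ∞)` with intensity function `rate`: a counting process with
independent increments such that `N t - N s` has the Poisson distribution with mean
`∫_s^t rate(u) du`. -/
structure IsPoissonCounting {Ω : Type*} [MeasurableSpace Ω] (P : Measure Ω)
    (rate : ℝ → ℝ) (N : ℝ≥0 → Ω → ℕ) : Prop where
  measurable : ∀ t, Measurable (N t)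
  zero : ∀ᵐ ω ∂P, N 0 ω = 0
  mono : ∀ ω, Monotone fun t => N t ω
  right_continuous : ∀ ω t, ContinuousWithinAt (fun s => N s ω) (Set.Ici t) t
  indep_increments : HasIndepIncrements (fun t ω => (N t ω : ℝ)) P
  law_increment : ∀ s t : ℝ≥0, s ≤ t →
    HasLaw (fun ω => N t ω - N s ω) (poissonMeasure (∫ u in (s : ℝ)..t, rate u).toNNReal) P

/-- The `n`-th arrival time `Υ_n` of a counting process. It only enters below for `n ≤ N t ω`,
where the infimum is over a nonempty set. -/
def arrivalTime {Ω : Type*} (N : ℝ≥0 → Ω → ℕ) (n : ℕ) (ω : Ω) : ℝ≥0 :=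
  sInf {t | n ≤ N t ω}

/-- The deterministic data of a simple semi-Lévy process: a partition `0 = t_0 < t_1 < ⋯` whose
cell lengths are periodic with `l` cells per period, an intensity and a drift with period
`τ = t_l`, and the jump distributions `F_1, …, F_l` (indexed here by `0, …, l - 1`). -/
structure SemiLevyData where
  l : ℕ
  l_pos : 0 < l
  part : ℕ → ℝ≥0
  part_zero : part 0 = 0
  part_strictMono : StrictMono part
  part_periodic : ∀ j, (part (j + 1 + l) : ℝ) - part (j + l) = part (j + 1) - part j
  rate : ℝ → ℝ
  rate_nonneg : ∀ u, 0 ≤ u → 0 ≤ rate u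
  rate_periodic : ∀ u, 0 ≤ u → rate (u + part l) = rate u
  rate_integrable : ∀ t : ℝ≥0, IntervalIntegrable rate volume 0 t
  drift : ℝ≥0 → ℝ
  drift_zero : drift 0 = 0
  drift_periodic : ∀ t, drift (t + part l) = drift t
  drift_continuous : Continuous drift
  drift_finite_variation : LocallyBoundedVariationOn drift Set.univ
  F : Fin l → Measure ℝ
  F_probability : ∀ j, IsProbabilityMeasure (F j)
  F_second_moment : ∀ j, Integrable (fun z : ℝ => z ^ 2) (F j)

namespace SemiLevyData

/-- The period `τ = |A_1| + ⋯ + |A_l| = t_l`. -/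
def period (θ : SemiLevyData) : ℝ≥0 := θ.part θ.l

/-- The set `𝔇_j` of times that lie in the `j`-th cell of some period. -/
def cell (θ : SemiLevyData) (j : Fin θ.l) : Set ℝ≥0 :=
  ⋃ k : ℕ, Set.Ico (θ.part (j + k * θ.l)) (θ.part (j + 1 + k * θ.l))

open Classical in
/-- The `n`-th jump `Z_n = ∑_j Z_n^j 1{Υ_n ∈ 𝔇_j}`; `Z n j` is used for `n ≥ 1` only. -/
def jump {Ω : Type*} (θ : SemiLevyData) (N : ℝ≥0 → Ω → ℕ) (Z : ℕ+ → Fin θ.l → Ω → ℝ)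
    (n : ℕ+) (ω : Ω) : ℝ :=
  ∑ j : Fin θ.l, if arrivalTime N n ω ∈ θ.cell j then Z n j ω else 0

/-- The simple compound Poisson process `S_t = D_t + ∑_{n=1}^{N(t)} Z_n`. -/
def process {Ω : Type*} (θ : SemiLevyData) (N : ℝ≥0 → Ω → ℕ) (Z : ℕ+ → Fin θ.l → Ω → ℝ)
    (t : ℝ≥0) (ω : Ω) : ℝ :=
  θ.drift t + ∑ n ∈ Finset.range (N t ω), θ.jump N Z n.succPNat ω

/-- `(N, Z)` is a random source of a simple semi-Lévy process with data `θ`: `N` is a Poisson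
process with the given intensity, the `Z_n^j` are independent with laws `F_j`, and the family
`(Z_n^j)` is independent of the process `N`. -/
structure IsSource (θ : SemiLevyData) {Ω : Type*} [MeasurableSpace Ω] (P : Measure Ω)
    (N : ℝ≥0 → Ω → ℕ) (Z : ℕ+ → Fin θ.l → Ω → ℝ) : Prop where
  poisson : IsPoissonCounting P θ.rate N
  measurable_mark : ∀ n j, Measurable (Z n j)
  law_mark : ∀ n j, HasLaw (Z n j) (θ.F j) P
  indep_marks : iIndepFun (fun (i : ℕ+ × Fin θ.l) => Z i.1 i.2) P
  indep_poisson_marks :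
    IndepFun (fun ω (t : ℝ≥0) => N t ω) (fun ω (i : ℕ+ × Fin θ.l) => Z i.1 i.2 ω) P

end SemiLevyData

/-! ### The COGARCH process -/

/-- The parameters `α_0, α_1, …, α_q`, `β_1, …, β_q` of a COGARCH(p, q) process. The values of
`α` and `β` at other indices play no role. -/
structure CogarchParam (p q : ℕ) where
  α : ℕ → ℝ
  β : ℕ → ℝ
  one_le_p : 1 ≤ p
  p_le_q : p ≤ q
  α_zero_pos : 0 < α 0
  α_p_ne_zero : α p ≠ 0
  β_q_ne_zero : β q ≠ 0
  α_eq_zero : ∀ i, p < i → i ≤ q → α i = 0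

namespace CogarchParam

variable {p q : ℕ}

/-- The companion matrix `B`: ones on the superdiagonal, last row `(-β_q, …, -β_1)`. -/
def B (κ : CogarchParam p q) : Matrix (Fin q) (Fin q) ℝ :=
  Matrix.of fun i j =>
    if (i : ℕ) + 1 = q then -κ.β (q - j) else if (j : ℕ) = i + 1 then 1 else 0

/-- The vector `a = (α_1, …, α_q)'`. -/
def a (κ : CogarchParam p q) : Fin q → ℝ := fun i => κ.α (i + 1)

/-- The vector `e = (0, …, 0, 1)'`. -/
def e (_κ : CogarchParam p q) : Fin q → ℝ := fun i => if (i : ℕ) + 1 = q then 1 else 0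

/-- The volatility `V_t = α_0 + a' Y_{t-}` for `t > 0` and `V_0 = α_0 + a' Y_0`
(`Function.leftLim x 0 = x 0` on `[0, ∞)`). -/
def volatility (κ : CogarchParam p q) {Ω : Type*} (Y : ℝ≥0 → Ω → Fin q → ℝ)
    (t : ℝ≥0) (ω : Ω) : ℝ :=
  κ.α 0 + κ.a ⬝ᵥ Function.leftLim (fun s => Y s ω) t

/-- `Y` is the state process driven by `S`: a càdlàg solution of
`dY_t = B Y_{t-} dt + e (α_0 + a' Y_{t-}) d[S, S]_t` with `Y_0` independent of `S`. -/
structure IsStateSolution (κ : CogarchParam p q) {Ω : Type*} [MeasurableSpace Ω] (P : Measure Ω)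
    (S : ℝ≥0 → Ω → ℝ) (Y : ℝ≥0 → Ω → Fin q → ℝ) : Prop where
  measurable : ∀ t, Measurable (Y t)
  cadlag : ∀ᵐ ω ∂P, IsCadlag fun t => Y t ω
  sde : ∀ᵐ ω ∂P, ∀ (t : ℝ≥0) (i : Fin q),
    Y t ω i = Y 0 ω i
      + (∫ u in (0 : ℝ)..t, (κ.B.mulVec (Function.leftLim (fun s => Y s ω) u.toNNReal)) i)
      + κ.e i * stieltjesIntegral
          (fun u => κ.α 0 + κ.a ⬝ᵥ Function.leftLim (fun s => Y s ω) u)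
          (quadraticVariation fun s => S s ω) 0 t
  indep_initial : IndepFun (Y 0) (fun ω t => S t ω) P

end CogarchParam

/-- The increment `G_t^{(r)} = ∫_t^{t+r} √V_s dS_s` of length `r`. -/
def increment {Ω : Type*} (V S : ℝ≥0 → Ω → ℝ) (r t : ℝ≥0) (ω : Ω) : ℝ :=
  stieltjesIntegral (fun s => √(V s ω)) (fun s => S s ω) t (t + r)

/-! ### Periodicity of processes -/

/-- Strict periodic stationarity with period `τ`: the finite-dimensional distributions are
invariant under the shifts by `k τ`. -/
def IsStrictlyPeriodicallyStationary {Ω : Type*} [MeasurableSpace Ω] (P : Measure Ω) (τ : ℝ≥0)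
    (V : ℝ≥0 → Ω → ℝ) : Prop :=
  ∀ (n : ℕ) (s : Fin n → ℝ≥0) (J : Fin n → Set ℝ), (∀ i, MeasurableSet (J i)) → ∀ k : ℕ,
    P {ω | ∀ i, V (s i) ω ∈ J i} = P {ω | ∀ i, V (s i + k * τ) ω ∈ J i}

/-- A periodically correlated process with period `τ`: a second-order process whose mean and
covariance functions are invariant under the shifts by `k τ`. -/
structure IsPeriodicallyCorrelated {Ω : Type*} [MeasurableSpace Ω] (P : Measure Ω) (τ : ℝ≥0)
    (X : ℝ≥0 → Ω → ℝ) : Prop where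
  memLp : ∀ t, MemLp (X t) 2 P
  mean : ∀ (t : ℝ≥0) (k : ℕ), ∫ ω, X t ω ∂P = ∫ ω, X (t + k * τ) ω ∂P
  covariance : ∀ (t h : ℝ≥0) (k : ℕ),
    covariance (X t) (X (t + h)) P = covariance (X (t + k * τ)) (X (t + h + k * τ)) P

end

end SSCOGARCH

/-!
Two increments `G t` and `G (t + h)` are obtained from the state `Y` at time `t` and from the
increments of `S` after time `t`, by a functional that does not involve `t`. So it is enough that
the joint law of these two inputs is periodic in `t`; means and covariances are then equal because
the laws of the pairs `(G t, G (t + h))` and `(G (t + k τ), G (t + h + k τ))` are.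

The hypothesis concerns the volatility `V` only, and `V` need not determine `Y`. The state is
therefore replaced by the sequence of observables `w j = a' Bʲ Y` (`obs`). It carries all that
matters: multiplying the state equation by `a' Bʲ` gives
`d(w j) = w (j + 1) dt + (a' Bʲ e) (α₀ + w 0) d[S, S]`, in which only the sequence `w` occurs.

* *The functional.* The paths of `S` have finite variation, so everything is pathwise. The Euler
  scheme along uniform grids, with `d[S, S]` replaced by squared increments of `S`, converges to the
  solution, and at the level of observables it needs only their initial values and the increments
  of `S` (`SolvesPathwise.obs_eq_flow`). Riemann sums of `√V` against `S` turn this into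
  `SolvesPathwise.increment_eq`.
* *The law of the observables.* Each path of `S` is continuous on some interval `[t, t + ε)`. There
  `dY = B Y dt`, so that `w j` is the `j`-th right derivative of `V - α₀` and is a measurable
  functional of the path of `V` after `t` (`SolvesPathwise.germ_volatility`). The law of that path
  is periodic by hypothesis.
* *The law of the increments of `S` after `t`.* They are a functional of the Poisson process
  restarted at `t` and of the marks numbered from `N t + 1` on. The restarted process and the
  renumbered marks are independent of the past and have a law that is periodic in `t`
  (`IsPoissonCounting.indepFun_markedPast_markedFuture`, `IsPoissonCounting.map_markedFuture`).
* *Independence.* The observables at time `t` are a functional of `Y 0` and of the path of `S` up to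
  `t`, hence are independent of the increments after `t`
  (`SemiLevyData.IsSource.indepFun_obs_future`).

Functionals that are limits along actual paths are defined as `limsup`, so that they are measurable
functions on the whole path space.
-/

namespace SSCOGARCH

noncomputable section

open Filter Set

/-! ### Càdlàg paths -/

section Cadlag

variable {E F : Type*} [TopologicalSpace E] [TopologicalSpace F]

theorem IsCadlag.tendsto_leftLim {x : ℝ≥0 → E} (hx : IsCadlag x) (t : ℝ≥0) :
    Tendsto x (𝓝[<] t) (𝓝 (Function.leftLim x t)) :=
  tendsto_leftLim_of_tendsto (hx.left_limits t)

theorem IsCadlag.comp {x : ℝ≥0 → E} (hx : IsCadlag x) {φ : E → F} (hφ : Continuous φ) :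
    IsCadlag (fun t => φ (x t)) where
  right_continuous t := hφ.continuousAt.comp_continuousWithinAt (hx.right_continuous t)
  left_limits t := by
    obtain ⟨y, hy⟩ := hx.left_limits t
    exact ⟨φ y, (hφ.tendsto y).comp hy⟩

/-- Left limits commute with continuous maps; at the left end point both sides are the value. -/
theorem IsCadlag.leftLim_comp [T2Space E] [T2Space F] {x : ℝ≥0 → E} (hx : IsCadlag x)
    {φ : E → F} (hφ : Continuous φ) (t : ℝ≥0) :
    Function.leftLim (fun s => φ (x s)) t = φ (Function.leftLim x t) := by
  rcases eq_or_ne (𝓝[<] t) ⊥ with h | h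
  · rw [leftLim_eq_of_eq_bot _ h, leftLim_eq_of_eq_bot _ h]
  · have : (𝓝[<] t).NeBot := ⟨h⟩
    exact leftLim_eq_of_tendsto ((hφ.tendsto _).comp (hx.tendsto_leftLim t))

end Cadlag

theorem IsCadlag.exists_bound {x : ℝ≥0 → ℝ} (hx : IsCadlag x) (T : ℝ≥0) :
    ∃ C, 0 ≤ C ∧ ∀ t ≤ T, |x t| ≤ C := by
  have key : ∃ C, ∀ t ∈ Icc 0 T, |x t| ≤ C := by
    refine isCompact_Icc.induction_on (p := fun s => ∃ C, ∀ t ∈ s, |x t| ≤ C) ⟨0, by simp⟩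
      (fun s t hst ⟨C, hC⟩ => ⟨C, fun u hu => hC u (hst hu)⟩)
      (fun s t ⟨C, hC⟩ ⟨D, hD⟩ => ⟨max C D, fun u hu => ?_⟩) (fun t _ => ?_)
    · rcases hu with hu | hu
      · exact (hC u hu).trans (le_max_left _ _)
      · exact (hD u hu).trans (le_max_right _ _)
    · obtain ⟨y, hy⟩ := hx.left_limits t
      have h1 : ∀ᶠ u in 𝓝[<] t, |x u| ≤ |y| + 1 :=
        (hy.abs.eventually (gt_mem_nhds (lt_add_one _))).mono fun _ h => h.le
      have h2 : ∀ᶠ u in 𝓝[≥] t, |x u| ≤ |x t| + 1 :=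
        ((hx.right_continuous t).tendsto.abs.eventually (gt_mem_nhds (lt_add_one _))).mono
          fun _ h => h.le
      refine ⟨{u | |x u| ≤ max (|y| + 1) (|x t| + 1)}, mem_nhdsWithin_of_mem_nhds ?_,
        _, fun u hu => hu⟩
      have : 𝓝 t = 𝓝[<] t ⊔ 𝓝[≥] t := (nhdsLT_sup_nhdsGE t).symm
      rw [this]
      exact mem_sup.2 ⟨h1.mono fun u hu => hu.trans (le_max_left _ _),
        h2.mono fun u hu => hu.trans (le_max_right _ _)⟩
  obtain ⟨C, hC⟩ := key
  exact ⟨C, (abs_nonneg _).trans (hC 0 (by simp)), fun t ht => hC t ⟨zero_le, ht⟩⟩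

theorem nhdsLT_neBot_of_pos {t : ℝ≥0} (ht : 0 < t) : (𝓝[<] t).NeBot :=
  nhdsLT_neBot_of_exists_lt ⟨0, ht⟩

theorem IsCadlag.abs_leftLim_le {x : ℝ≥0 → ℝ} (hx : IsCadlag x) {T : ℝ≥0} {C : ℝ}
    (hC : ∀ t ≤ T, |x t| ≤ C) {t : ℝ≥0} (ht : t ≤ T) : |Function.leftLim x t| ≤ C := by
  rcases eq_or_ne t 0 with rfl | h0
  · rw [leftLim_eq_of_isBot (fun _ => zero_le)]; exact hC _ ht
  · have := nhdsLT_neBot_of_pos (pos_iff_ne_zero.2 h0)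
    refine le_of_tendsto (hx.tendsto_leftLim t).abs ?_
    filter_upwards [self_mem_nhdsWithin] with u hu
    exact hC u ((le_of_lt hu).trans ht)

/-- The largest point of the grid `a + δ ℕ` strictly to the left of `u`, for `a < u`.
Truncated subtraction gives the value `a` for `u ≤ a`. -/
def gridFloor (a δ u : ℝ≥0) : ℝ≥0 := a + δ * ((⌈(u - a) / δ⌉₊ - 1 : ℕ) : ℝ≥0)

theorem gridFloor_lt {a δ u : ℝ≥0} (hδ : 0 < δ) (hu : a < u) : gridFloor a δ u < u := by
  have h0 : 0 < (u - a) / δ := div_pos (tsub_pos_of_lt hu) hδ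
  have h1 : 0 < ⌈(u - a) / δ⌉₊ := Nat.ceil_pos.2 h0
  have h2 : ((⌈(u - a) / δ⌉₊ - 1 : ℕ) : ℝ≥0) < (u - a) / δ := by
    rw [← Nat.lt_ceil]; omega
  rw [lt_div_iff₀ hδ, lt_tsub_iff_left] at h2
  rw [gridFloor, mul_comm]; exact h2

theorem le_gridFloor_add (a u : ℝ≥0) {δ : ℝ≥0} (hδ : 0 < δ) : u ≤ gridFloor a δ u + δ := by
  have h2 : (u - a) / δ ≤ ((⌈(u - a) / δ⌉₊ - 1 : ℕ) : ℝ≥0) + 1 := by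
    refine (Nat.le_ceil _).trans ?_
    exact_mod_cast (by omega : ⌈(u - a) / δ⌉₊ ≤ ⌈(u - a) / δ⌉₊ - 1 + 1)
  rw [div_le_iff₀ hδ, tsub_le_iff_left] at h2
  rw [gridFloor, add_assoc]
  refine h2.trans_eq ?_
  ring

theorem gridFloor_eq {a δ u : ℝ≥0} (hδ : 0 < δ) (i : ℕ)
    (hu : u ∈ Ioc (a + δ * i) (a + δ * (i + 1 : ℕ))) :
    gridFloor a δ u = a + δ * i := by
  have : ⌈(u - a) / δ⌉₊ = i + 1 := by
    rw [Nat.ceil_eq_iff (by omega)]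
    constructor
    · rw [lt_div_iff₀ hδ, lt_tsub_iff_left, mul_comm]; simpa using hu.1
    · rw [div_le_iff₀ hδ, tsub_le_iff_left, mul_comm]; exact hu.2
  simp [gridFloor, this]

theorem tendsto_gridFloor {a u : ℝ≥0} (hu : a < u) {δ : ℕ → ℝ≥0} (hδ : ∀ᶠ n in atTop, 0 < δ n)
    (hδ0 : Tendsto δ atTop (𝓝 0)) :
    Tendsto (fun n => gridFloor a (δ n) u) atTop (𝓝[<] u) := by
  refine tendsto_nhdsWithin_iff.2 ⟨?_, hδ.mono fun n h => gridFloor_lt h hu⟩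
  have h1 : Tendsto (fun n => u - δ n) atTop (𝓝 u) := by
    simpa using (tendsto_const_nhds (x := u)).sub hδ0
  exact tendsto_of_tendsto_of_tendsto_of_le_of_le' h1 tendsto_const_nhds
    (hδ.mono fun n h => tsub_le_iff_right.2 (le_gridFloor_add a u h))
    (hδ.mono fun n h => (gridFloor_lt h hu).le)

theorem measurable_comp_gridFloor (a δ : ℝ≥0) (φ : ℝ≥0 → ℝ) :
    Measurable fun u => φ (gridFloor a δ u) := by
  have h : Measurable fun u : ℝ≥0 => ⌈(u - a) / δ⌉₊ :=
    Nat.measurable_ceil.comp (by fun_prop)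
  exact (measurable_from_nat (f := fun k : ℕ => φ (a + δ * ((k - 1 : ℕ) : ℝ≥0)))).comp h

theorem IsCadlag.measurable_leftLim {x : ℝ≥0 → ℝ} (hx : IsCadlag x) :
    Measurable (Function.leftLim x) := by
  have hδ : ∀ n : ℕ, (0 : ℝ≥0) < 1 / ((n : ℝ≥0) + 1) := fun n => by positivity
  refine measurable_of_tendsto_metrizable
    (fun n : ℕ => measurable_comp_gridFloor 0 (1 / ((n : ℝ≥0) + 1)) x)
    (tendsto_pi_nhds.2 fun u => ?_)
  rcases eq_or_ne u 0 with rfl | h0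
  · rw [leftLim_eq_of_isBot (fun _ => zero_le)]
    simp [gridFloor]
  · exact (hx.tendsto_leftLim u).comp (tendsto_gridFloor (pos_iff_ne_zero.2 h0)
      (Eventually.of_forall hδ) (tendsto_one_div_add_atTop_nhds_zero_nat))

/-- The measure-theoretic core of all the Riemann-sum limits: along uniform grids of
`[a, a + L]`, the mean oscillation of a càdlàg path, to the right of the left end point of each
cell, tends to zero. -/
theorem IsCadlag.tendsto_sum_integral_oscillation {x : ℝ≥0 → ℝ} (hx : IsCadlag x)
    (m : Measure ℝ≥0) [IsFiniteMeasure m] (a L : ℝ≥0) :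
    Tendsto (fun n : ℕ => ∑ i ∈ Finset.range n,
      ∫ u in Ioc (a + L / n * i) (a + L / n * (i + 1 : ℕ)),
        |Function.leftLim x u - x (a + L / n * i)| ∂m) atTop (𝓝 0) := by
  rcases eq_or_ne L 0 with rfl | hL
  · simp
  have hL : 0 < L := pos_iff_ne_zero.2 hL
  obtain ⟨C, hC0, hC⟩ := hx.exists_bound (a + L)
  have hδ : ∀ᶠ n : ℕ in atTop, 0 < L / n := by
    filter_upwards [eventually_gt_atTop 0] with n hn
    positivity
  have hδ0 : Tendsto (fun n : ℕ => L / (n : ℝ≥0)) atTop (𝓝 0) :=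
    tendsto_const_div_atTop_nhds_zero_nat L
  have hmeas : ∀ n : ℕ, Measurable fun u => |Function.leftLim x u - x (gridFloor a (L / n) u)| :=
    fun n => (hx.measurable_leftLim.sub (measurable_comp_gridFloor _ _ _)).abs
  have hbound : ∀ᶠ n : ℕ in atTop, ∀ u ∈ Ioc a (a + L),
      |Function.leftLim x u - x (gridFloor a (L / n) u)| ≤ 2 * C := by
    filter_upwards [hδ] with n hn u hu
    have h1 := hx.abs_leftLim_le hC hu.2
    have h2 := hC _ ((gridFloor_lt hn hu.1).le.trans hu.2)
    calc _ ≤ _ := abs_sub _ _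
      _ ≤ 2 * C := by linarith
  have hlim : Tendsto (fun n : ℕ => ∫ u in Ioc a (a + L),
      |Function.leftLim x u - x (gridFloor a (L / n) u)| ∂m) atTop (𝓝 0) := by
    have := tendsto_integral_filter_of_dominated_convergence (μ := m.restrict (Ioc a (a + L)))
      (F := fun n : ℕ => fun u => |Function.leftLim x u - x (gridFloor a (L / n) u)|)
      (f := fun _ => 0) (l := atTop) (fun _ => 2 * C)
      (Eventually.of_forall fun n => (hmeas n).aestronglyMeasurable)
      (hbound.mono fun n hn => (ae_restrict_iff' measurableSet_Ioc).2
        (Eventually.of_forall fun u hu => by simpa using hn u hu))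
      (integrable_const _)
      ((ae_restrict_iff' measurableSet_Ioc).2 (Eventually.of_forall fun u hu => by
        have := (hx.tendsto_leftLim u).comp (tendsto_gridFloor hu.1 hδ hδ0)
        simpa using (tendsto_const_nhds (x := Function.leftLim x u)).sub this |>.abs))
    simpa using this
  refine hlim.congr' ?_
  filter_upwards [hδ, hbound, eventually_gt_atTop 0] with n hn hb hn0
  have hmono : Monotone fun i : ℕ => a + L / n * (i : ℝ≥0) := fun i j hij => by
    dsimp only; gcongr
  have hend : a + L / n * (n : ℝ≥0) = a + L := by
    rw [div_mul_cancel₀]; exact_mod_cast hn0.ne'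
  have hint : IntegrableOn (fun u => |Function.leftLim x u - x (gridFloor a (L / n) u)|)
      (Ioc a (a + L)) m := by
    refine Measure.integrableOn_of_bounded (M := 2 * C) (measure_ne_top _ _)
      (hmeas n).aestronglyMeasurable ((ae_restrict_iff' measurableSet_Ioc).2
        (Eventually.of_forall fun u hu => by simpa using hb u hu))
  have hsum : ∀ k ≤ n, ∑ i ∈ Finset.range k, ∫ u in Ioc (a + L / n * i) (a + L / n * (i + 1 : ℕ)),
        |Function.leftLim x u - x (a + L / n * i)| ∂m
      = ∫ u in Ioc a (a + L / n * k), |Function.leftLim x u - x (gridFloor a (L / n) u)| ∂m := by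
    intro k hk
    induction k with
    | zero => simp
    | succ k ih =>
      have h1 : a ≤ a + L / n * (k : ℝ≥0) := le_self_add
      have h2 := hmono (Nat.le_succ k)
      have h3 : a + L / n * ((k + 1 : ℕ) : ℝ≥0) ≤ a + L := hend ▸ hmono hk
      rw [Finset.sum_range_succ, ih (by omega), ← Ioc_union_Ioc_eq_Ioc h1 h2,
        setIntegral_union (Ioc_disjoint_Ioc_of_le le_rfl) measurableSet_Ioc
          (hint.mono_set (Ioc_subset_Ioc_right (h2.trans h3)))
          (hint.mono_set (Ioc_subset_Ioc h1 h3))]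
      congr 1
      refine setIntegral_congr_fun measurableSet_Ioc fun u hu => ?_
      rw [gridFloor_eq hn k hu]
  rw [hsum n le_rfl, hend]

/-! ### Lebesgue–Stieltjes integrals of left limits -/

theorem boundedVariationOn_inter_Icc_of_abs_sub_le {f F : ℝ≥0 → ℝ} (T : ℝ≥0)
    (h : ∀ c d, c ≤ d → d ≤ T → |f d - f c| ≤ F d - F c) :
    BoundedVariationOn f (univ ∩ Icc 0 T) := by
  have hF : MonotoneOn F (Icc 0 T) := fun c _ d hd hcd =>
    sub_nonneg.1 ((abs_nonneg _).trans (h c d hcd hd.2))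
  have h0 := hF.locallyBoundedVariationOn 0 T (by simp) (by simp)
  rw [inter_self] at h0
  rw [univ_inter]
  refine ne_top_of_le_ne_top h0 ?_
  refine iSup_mono fun p => Finset.sum_le_sum fun i _ => ?_
  have hle := p.2.2.1 (Nat.le_succ i)
  rw [edist_dist, edist_dist, Real.dist_eq, Real.dist_eq]
  exact ENNReal.ofReal_le_ofReal ((h _ _ hle (p.2.2.2 _).2).trans (le_abs_self _))

/-- A path that is càdlàg and has finite variation on compact intervals. -/
structure IsFV (g : ℝ≥0 → ℝ) : Prop where
  cadlag : IsCadlag g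
  variation : LocallyBoundedVariationOn g univ

theorem stopped_boundedVariationOn {g : ℝ≥0 → ℝ} (hg : LocallyBoundedVariationOn g univ)
    (T : ℝ≥0) : BoundedVariationOn (fun u => g (min u T)) univ := by
  refine ne_top_of_le_ne_top (hg 0 T (mem_univ _) (mem_univ _)) ?_
  exact eVariationOn.comp_le_of_monotoneOn g (fun u => min u T)
    (fun a _ b _ hab => min_le_min_right T hab) fun u _ => ⟨mem_univ _, zero_le, min_le_right _ _⟩

/-- A right-continuous path of finite variation has left limits. -/
theorem IsFV.of_right_continuous {g : ℝ≥0 → ℝ} (hr : ∀ t, ContinuousWithinAt g (Ici t) t)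
    (hg : LocallyBoundedVariationOn g univ) : IsFV g where
  cadlag :=
    { right_continuous := hr
      left_limits := fun t => by
        refine ⟨_, ((stopped_boundedVariationOn hg t).tendsto_leftLim t).congr' ?_⟩
        filter_upwards [self_mem_nhdsWithin] with u hu
        rw [min_eq_left (le_of_lt hu)] }
  variation := hg

/-- The signed measure on `[0, ∞)` of a finite variation path stopped at `T`. -/
def IsFV.signedMeasure {g : ℝ≥0 → ℝ} (hg : IsFV g) (T : ℝ≥0) : SignedMeasure ℝ≥0 :=
  (stopped_boundedVariationOn hg.variation T).vectorMeasure

/-- The total variation measure of a finite variation path stopped at `T`. -/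
def IsFV.totalVariation {g : ℝ≥0 → ℝ} (hg : IsFV g) (T : ℝ≥0) : Measure ℝ≥0 :=
  (hg.signedMeasure T).variation

instance IsFV.isFiniteMeasure_totalVariation {g : ℝ≥0 → ℝ} (hg : IsFV g) (T : ℝ≥0) :
    IsFiniteMeasure (hg.totalVariation T) := by
  rw [IsFV.totalVariation, ← SignedMeasure.totalVariation_eq_variation]
  infer_instance

section

variable {g φ : ℝ≥0 → ℝ} (hg : IsFV g) (T : ℝ≥0)

theorem IsFV.signedMeasure_Ioc {c d : ℝ≥0} (hcd : c ≤ d) (hd : d ≤ T) :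
    hg.signedMeasure T (Ioc c d) = g d - g c := by
  have h : ∀ t ≤ T, Function.rightLim (fun u => g (min u T)) t = g t := by
    intro t ht
    rw [ContinuousWithinAt.rightLim_eq]
    · simp [ht]
    · have h1 := hg.cadlag.right_continuous t
      have h2 : ContinuousWithinAt (fun u : ℝ≥0 => min u T) (Ici t) t := by fun_prop
      have h3 : ContinuousWithinAt g (Ici t) (min t T) := by rwa [min_eq_left ht]
      exact ContinuousWithinAt.comp (f := fun u : ℝ≥0 => min u T) h3 h2 fun u hu => le_min hu ht
  rw [IsFV.signedMeasure, BoundedVariationOn.vectorMeasure_Ioc _ hcd, h d hd, h c (hcd.trans hd)]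

theorem IsFV.abs_sub_le {c d : ℝ≥0} (hcd : c ≤ d) (hd : d ≤ T) :
    |g d - g c| ≤ (hg.totalVariation T).real (Ioc c d) := by
  rw [← hg.signedMeasure_Ioc T hcd hd]
  exact VectorMeasure.norm_measure_le_variation (hE := measure_ne_top (hg.totalVariation T) _)

/-- The integral of `φ_{u-}` over `(c, d]` against the path `g` stopped at `T`. -/
def IsFV.integralTo (φ : ℝ≥0 → ℝ) (c d : ℝ≥0) : ℝ :=
  ∫ᵛ u in Ioc c d, Function.leftLim φ u ∂•(hg.signedMeasure T)

theorem IsFV.integrable_leftLim (hφ : IsCadlag φ) {c d : ℝ≥0} :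
    (hg.signedMeasure T).IntegrableOn (Function.leftLim φ) (Ioc c d) := by
  obtain ⟨C, -, hC⟩ := hφ.exists_bound d
  rw [VectorMeasure.IntegrableOn, VectorMeasure.Integrable,
    VectorMeasure.variation_restrict measurableSet_Ioc]
  exact Measure.integrableOn_of_bounded (M := C) (measure_ne_top (hg.totalVariation T) _)
      hφ.measurable_leftLim.aestronglyMeasurable ((ae_restrict_iff' measurableSet_Ioc).2
        (Eventually.of_forall fun u hu => hφ.abs_leftLim_le hC hu.2))

theorem IsFV.integralTo_add (hφ : IsCadlag φ) {c d e : ℝ≥0} (hcd : c ≤ d) (hde : d ≤ e) :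
    hg.integralTo T φ c d + hg.integralTo T φ d e = hg.integralTo T φ c e := by
  rw [IsFV.integralTo, IsFV.integralTo, IsFV.integralTo, ← Ioc_union_Ioc_eq_Ioc hcd hde,
    VectorMeasure.setIntegral_union (Ioc_disjoint_Ioc_of_le le_rfl) measurableSet_Ioc
      measurableSet_Ioc (hg.integrable_leftLim T hφ) (hg.integrable_leftLim T hφ)]

theorem IsFV.abs_integralTo_sub_le (hφ : IsCadlag φ) {c d : ℝ≥0} (hcd : c ≤ d) (hd : d ≤ T) :
    |hg.integralTo T φ c d - φ c * (g d - g c)|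
      ≤ ∫ u in Ioc c d, |Function.leftLim φ u - φ c| ∂(hg.totalVariation T) := by
  have hfin : IsFiniteMeasure
      (VectorMeasure.variation ((hg.signedMeasure T).restrict (Ioc c d))) := by
    rw [VectorMeasure.variation_restrict measurableSet_Ioc]
    change IsFiniteMeasure ((hg.totalVariation T).restrict _)
    infer_instance
  have hconst : φ c * (g d - g c) = ∫ᵛ _u in Ioc c d, φ c ∂•(hg.signedMeasure T) := by
    rw [VectorMeasure.integral_const, VectorMeasure.restrict_apply _ measurableSet_Ioc .univ,
      univ_inter, hg.signedMeasure_Ioc T hcd hd]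
    simp
  rw [hconst, IsFV.integralTo, ← VectorMeasure.integral_sub (hg.integrable_leftLim T hφ)
    (integrable_const _)]
  rw [← Real.norm_eq_abs]
  refine VectorMeasure.norm_integral_le_integral_norm.trans ?_
  rw [VectorMeasure.variation_restrict measurableSet_Ioc]
  refine (mul_le_of_le_one_left (integral_nonneg fun _ => norm_nonneg _)
    (ContinuousLinearMap.opNorm_lsmul_le)).trans ?_
  rfl

theorem IsFV.tendsto_riemannSum_integralTo (hφ : IsCadlag φ) {a L : ℝ≥0} (hT : a + L ≤ T) :
    Tendsto (fun n : ℕ => ∑ i ∈ Finset.range n, φ (a + L / n * i) *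
      (g (a + L / n * (i + 1 : ℕ)) - g (a + L / n * i))) atTop
      (𝓝 (hg.integralTo T φ a (a + L))) := by
  rw [tendsto_iff_dist_tendsto_zero]
  refine squeeze_zero' (Eventually.of_forall fun _ => dist_nonneg) ?_
    (hφ.tendsto_sum_integral_oscillation (hg.totalVariation T) a L)
  filter_upwards [eventually_gt_atTop 0] with n hn
  have hmono : Monotone fun i : ℕ => a + L / n * (i : ℝ≥0) := fun i j hij => by
    dsimp only; gcongr
  have hend : a + L / n * (n : ℝ≥0) = a + L := by
    rw [div_mul_cancel₀]; exact_mod_cast hn.ne'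
  have hsum : ∀ k : ℕ, ∑ i ∈ Finset.range k,
      hg.integralTo T φ (a + L / n * i) (a + L / n * (i + 1 : ℕ))
      = hg.integralTo T φ a (a + L / n * k) := by
    intro k
    induction k with
    | zero => simp [IsFV.integralTo]
    | succ k ih =>
      rw [Finset.sum_range_succ, ih, hg.integralTo_add T hφ le_self_add (hmono (Nat.le_succ k))]
  rw [dist_comm, Real.dist_eq, ← hend, ← hsum n, ← Finset.sum_sub_distrib]
  refine (Finset.abs_sum_le_sum_abs _ _).trans (Finset.sum_le_sum fun i hi => ?_)
  exact hg.abs_integralTo_sub_le T hφ (hmono (Nat.le_succ i))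
    ((hmono (Finset.mem_range.1 hi)).trans (hend.le.trans hT))

theorem IsFV.stieltjesIntegral_eq (hφ : IsCadlag φ) {c d : ℝ≥0} (hcd : c ≤ d) (hd : d ≤ T) :
    stieltjesIntegral (Function.leftLim φ) g c d = hg.integralTo T φ c d := by
  obtain ⟨L, rfl⟩ := exists_add_of_le hcd
  -- Both sides are limits of the same Riemann sums, which do not see where `g` is stopped.
  have h : stieltjesIntegral (Function.leftLim φ) g c (c + L)
      = hg.integralTo (c + L) φ c (c + L) := by
    rw [stieltjesIntegral, dif_pos (stopped_boundedVariationOn hg.variation _)]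
    rfl
  rw [h]
  exact tendsto_nhds_unique (hg.tendsto_riemannSum_integralTo (c + L) hφ le_rfl)
    (hg.tendsto_riemannSum_integralTo T hφ hd)

end

section

variable {g φ : ℝ≥0 → ℝ}

theorem IsFV.stieltjesIntegral_add (hg : IsFV g) (hφ : IsCadlag φ) {c d e : ℝ≥0} (hcd : c ≤ d)
    (hde : d ≤ e) :
    stieltjesIntegral (Function.leftLim φ) g c d + stieltjesIntegral (Function.leftLim φ) g d e
      = stieltjesIntegral (Function.leftLim φ) g c e := by
  rw [hg.stieltjesIntegral_eq e hφ hcd hde, hg.stieltjesIntegral_eq e hφ hde le_rfl,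
    hg.stieltjesIntegral_eq e hφ (hcd.trans hde) le_rfl, hg.integralTo_add e hφ hcd hde]

theorem IsFV.abs_stieltjesIntegral_sub_le (hg : IsFV g) (hφ : IsCadlag φ) {c d T : ℝ≥0}
    (hcd : c ≤ d) (hd : d ≤ T) :
    |stieltjesIntegral (Function.leftLim φ) g c d - φ c * (g d - g c)|
      ≤ ∫ u in Ioc c d, |Function.leftLim φ u - φ c| ∂(hg.totalVariation T) := by
  rw [hg.stieltjesIntegral_eq T hφ hcd hd]
  exact hg.abs_integralTo_sub_le T hφ hcd hd

theorem IsFV.tendsto_riemannSum (hg : IsFV g) (hφ : IsCadlag φ) (a L : ℝ≥0) :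
    Tendsto (fun n : ℕ => ∑ i ∈ Finset.range n, φ (a + L / n * i) *
      (g (a + L / n * (i + 1 : ℕ)) - g (a + L / n * i))) atTop
      (𝓝 (stieltjesIntegral (Function.leftLim φ) g a (a + L))) := by
  rw [hg.stieltjesIntegral_eq (a + L) hφ le_self_add le_rfl]
  exact hg.tendsto_riemannSum_integralTo (a + L) hφ le_rfl

end

/-! ### The quadratic variation -/

section QuadraticVariation

variable {x : ℝ≥0 → ℝ}

theorem IsFV.quadraticVariation_sub (hx : IsFV x) {c d : ℝ≥0} (hcd : c ≤ d) :
    quadraticVariation x d - quadraticVariation x c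
      = (x d - x c) ^ 2 - 2 * (stieltjesIntegral (Function.leftLim x) x c d
          - x c * (x d - x c)) := by
  have := hx.stieltjesIntegral_add hx.cadlag (zero_le (a := c)) hcd
  simp only [quadraticVariation]
  rw [← this]
  ring

/-- Over a small interval the quadratic variation is the squared increment, up to the
oscillation of the path. -/
theorem IsFV.abs_quadraticVariation_sub_le (hx : IsFV x) {c d T : ℝ≥0} (hcd : c ≤ d)
    (hd : d ≤ T) :
    |quadraticVariation x d - quadraticVariation x c - (x d - x c) ^ 2|
      ≤ 2 * ∫ u in Ioc c d, |Function.leftLim x u - x c| ∂(hx.totalVariation T) := by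
  have h := hx.abs_stieltjesIntegral_sub_le hx.cadlag hcd hd
  rw [hx.quadraticVariation_sub hcd, sub_sub_cancel_left, abs_neg, abs_mul, abs_two]
  linarith

theorem IsFV.tendsto_sum_sq (hx : IsFV x) (a L : ℝ≥0) :
    Tendsto (fun n : ℕ => ∑ i ∈ Finset.range n,
      (x (a + L / n * (i + 1 : ℕ)) - x (a + L / n * i)) ^ 2) atTop
      (𝓝 (quadraticVariation x (a + L) - quadraticVariation x a)) := by
  have h := hx.tendsto_riemannSum hx.cadlag a L
  rw [hx.quadraticVariation_sub le_self_add]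
  have h2 : ∀ᶠ n : ℕ in atTop, (x (a + L) - x a) ^ 2 - 2 * ((∑ i ∈ Finset.range n,
      x (a + L / n * i) * (x (a + L / n * (i + 1 : ℕ)) - x (a + L / n * i)))
        - x a * (x (a + L) - x a))
      = ∑ i ∈ Finset.range n, (x (a + L / n * (i + 1 : ℕ)) - x (a + L / n * i)) ^ 2 := by
    filter_upwards [eventually_gt_atTop 0] with n hn
    have hend : a + L / n * (n : ℝ≥0) = a + L := by
      rw [div_mul_cancel₀]; exact_mod_cast hn.ne'
    have hs := Finset.sum_range_sub (fun i : ℕ => x (a + L / n * i) ^ 2) n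
    simp only [hend, Nat.cast_zero, mul_zero, add_zero] at hs
    have : ∑ i ∈ Finset.range n, (x (a + L / n * (i + 1 : ℕ)) - x (a + L / n * i)) ^ 2
        = ∑ i ∈ Finset.range n, (x (a + L / n * (i + 1 : ℕ)) ^ 2 - x (a + L / n * i) ^ 2)
          - 2 * ∑ i ∈ Finset.range n,
            x (a + L / n * i) * (x (a + L / n * (i + 1 : ℕ)) - x (a + L / n * i)) := by
      rw [Finset.mul_sum, ← Finset.sum_sub_distrib]
      exact Finset.sum_congr rfl fun i _ => by ring
    rw [this, hs]
    ring
  refine Tendsto.congr' h2 ?_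
  exact (((h.sub_const _).const_mul 2).const_sub _)

theorem IsFV.isFV_quadraticVariation (hx : IsFV x) : IsFV (quadraticVariation x) := by
  have key : ∀ T : ℝ≥0, ∃ K, 0 ≤ K ∧ ∀ c d, c ≤ d → d ≤ T →
      |quadraticVariation x d - quadraticVariation x c|
        ≤ K * (hx.totalVariation T).real (Ioc c d) := by
    intro T
    obtain ⟨C, hC0, hC⟩ := hx.cadlag.exists_bound T
    refine ⟨6 * C, by positivity, fun c d hcd hd => ?_⟩
    have h1 := hx.abs_quadraticVariation_sub_le hcd hd
    have h2 : ∫ u in Ioc c d, |Function.leftLim x u - x c| ∂(hx.totalVariation T)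
        ≤ 2 * C * (hx.totalVariation T).real (Ioc c d) := by
      refine (Real.le_norm_self _).trans
        (norm_setIntegral_le_of_norm_le_const (measure_lt_top _ _) fun u hu => ?_)
      have h3 := hx.cadlag.abs_leftLim_le hC (hu.2.trans hd)
      have h4 := hC c (hcd.trans hd)
      rw [Real.norm_eq_abs, abs_abs]
      exact (abs_sub _ _).trans (by linarith)
    have h3 : (x d - x c) ^ 2 ≤ 2 * C * (hx.totalVariation T).real (Ioc c d) := by
      rw [← sq_abs, sq]
      have h4 : |x d - x c| ≤ 2 * C :=
        (abs_sub _ _).trans (by linarith [hC d hd, hC c (hcd.trans hd)])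
      exact mul_le_mul h4 (hx.abs_sub_le T hcd hd) (abs_nonneg _) (by positivity)
    have h5 := abs_sub_abs_le_abs_sub (quadraticVariation x d - quadraticVariation x c)
      ((x d - x c) ^ 2)
    rw [abs_of_nonneg (sq_nonneg (x d - x c))] at h5
    linarith
  refine IsFV.of_right_continuous (fun t => ?_) fun a b _ _ => ?_
  · obtain ⟨K, hK0, hK⟩ := key (t + 1)
    rw [← continuousWithinAt_Ioi_iff_Ici]
    have h1 : Tendsto (fun d => (hx.totalVariation (t + 1)).real (Ioc t d)) (𝓝[>] t) (𝓝 0) := by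
      have := tendsto_measure_biInter_gt (μ := hx.totalVariation (t + 1)) (s := fun d => Ioc t d)
        (a := t) (fun r _ => measurableSet_Ioc.nullMeasurableSet)
        (fun i j _ hij => Ioc_subset_Ioc_right hij) ⟨t + 1, by simp, measure_ne_top _ _⟩
      have he : ⋂ r, ⋂ (_ : r > t), Ioc t r = ∅ := by
        refine eq_empty_of_forall_notMem fun u hu => ?_
        simp only [mem_iInter, mem_Ioc] at hu
        have h0 : t < u := (hu (t + 1) (by simp)).1
        obtain ⟨v, hv1, hv2⟩ := exists_between h0
        exact absurd (hu v hv1).2 (not_le.2 hv2)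
      rw [he, measure_empty] at this
      exact (ENNReal.tendsto_toReal ENNReal.zero_ne_top).comp this
    rw [ContinuousWithinAt, tendsto_iff_dist_tendsto_zero]
    refine squeeze_zero' (Eventually.of_forall fun _ => dist_nonneg) ?_
      (by simpa using h1.const_mul K)
    filter_upwards [self_mem_nhdsWithin, mem_nhdsWithin_of_mem_nhds (Iic_mem_nhds
      (show t < t + 1 by simp))] with d hd hd1
    rw [Real.dist_eq]
    exact hK t d (le_of_lt hd) hd1
  · obtain ⟨K, hK0, hK⟩ := key b
    refine BoundedVariationOn.mono (boundedVariationOn_inter_Icc_of_abs_sub_le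
      (F := fun u => K * (hx.totalVariation b).real (Iic u)) b fun c d hcd hd => ?_)
      (inter_subset_inter_right _ (Icc_subset_Icc_left zero_le))
    refine (hK c d hcd hd).trans_eq ?_
    rw [← mul_sub, ← Iic_union_Ioc_eq_Iic hcd, measureReal_union (Iic_disjoint_Ioc le_rfl)
      measurableSet_Ioc, add_sub_cancel_left]

end QuadraticVariation

/-! ### Time integrals of left limits -/

/-- Lebesgue measure on `(0, T]`, as a measure on `[0, ∞)`. -/
def lebesgueTo (T : ℝ≥0) : Measure ℝ≥0 :=
  (volume.restrict (Ioc 0 (T : ℝ))).map Real.toNNReal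

instance (T : ℝ≥0) : IsFiniteMeasure (lebesgueTo T) := by
  unfold lebesgueTo; infer_instance

theorem setIntegral_lebesgueTo {f : ℝ≥0 → ℝ} (hf : Measurable f) {c d T : ℝ≥0} (hcd : c ≤ d)
    (hd : d ≤ T) :
    ∫ u in Ioc c d, f u ∂(lebesgueTo T) = ∫ u in (c : ℝ)..d, f u.toNNReal := by
  rw [lebesgueTo, setIntegral_map measurableSet_Ioc hf.aestronglyMeasurable
    measurable_real_toNNReal.aemeasurable, Measure.restrict_restrict
    (measurable_real_toNNReal measurableSet_Ioc),
    intervalIntegral.integral_of_le (NNReal.coe_le_coe.2 hcd)]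
  congr 2
  ext u
  simp only [mem_inter_iff, mem_preimage, mem_Ioc, Real.lt_toNNReal_iff_coe_lt,
    Real.toNNReal_le_iff_le_coe]
  constructor
  · rintro ⟨⟨h1, h2⟩, -⟩; exact ⟨h1, h2⟩
  · rintro ⟨h1, h2⟩
    exact ⟨⟨h1, h2⟩, c.coe_nonneg.trans_lt h1, h2.trans (NNReal.coe_le_coe.2 hd)⟩

theorem IsCadlag.intervalIntegrable_leftLim {ψ : ℝ≥0 → ℝ} (hψ : IsCadlag ψ) (c d : ℝ≥0) :
    IntervalIntegrable (fun u : ℝ => Function.leftLim ψ u.toNNReal) volume c d := by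
  wlog hcd : c ≤ d generalizing c d
  · exact (this d c (le_of_not_ge hcd)).symm
  obtain ⟨C, -, hC⟩ := hψ.exists_bound d
  rw [intervalIntegrable_iff_integrableOn_Ioc_of_le (NNReal.coe_le_coe.2 hcd)]
  exact Measure.integrableOn_of_bounded (M := C) (by simp)
    (hψ.measurable_leftLim.comp measurable_real_toNNReal).aestronglyMeasurable
    ((ae_restrict_iff' measurableSet_Ioc).2 (Eventually.of_forall fun u hu =>
      hψ.abs_leftLim_le hC (Real.toNNReal_le_iff_le_coe.2 hu.2)))

theorem IsCadlag.abs_timeIntegral_sub_le {ψ : ℝ≥0 → ℝ} (hψ : IsCadlag ψ) {c d T : ℝ≥0}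
    (hcd : c ≤ d) (hd : d ≤ T) :
    |(∫ u in (c : ℝ)..d, Function.leftLim ψ u.toNNReal) - ((d : ℝ) - c) * ψ c|
      ≤ ∫ u in Ioc c d, |Function.leftLim ψ u - ψ c| ∂(lebesgueTo T) := by
  rw [setIntegral_lebesgueTo (hψ.measurable_leftLim.sub_const _).abs hcd hd]
  have h : ((d : ℝ) - c) * ψ c = ∫ _u in (c : ℝ)..d, ψ c := by simp
  rw [h, ← intervalIntegral.integral_sub (hψ.intervalIntegrable_leftLim c d) (by simp)]
  exact intervalIntegral.abs_integral_le_integral_abs (NNReal.coe_le_coe.2 hcd)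

theorem IsCadlag.tendsto_leftLim_right {ψ : ℝ≥0 → ℝ} (hψ : IsCadlag ψ) (s : ℝ≥0) :
    Tendsto (Function.leftLim ψ) (𝓝[>] s) (𝓝 (ψ s)) := by
  rw [Metric.tendsto_nhds]
  intro η hη
  have h1 : ∀ᶠ u in 𝓝[>] s, dist (ψ u) (ψ s) < η / 2 :=
    Metric.tendsto_nhds.1 ((hψ.right_continuous s).mono Ioi_subset_Ici_self) _ (half_pos hη)
  obtain ⟨b, hb, hsub⟩ := (mem_nhdsGT_iff_exists_Ioo_subset' (lt_add_one s)).1 h1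
  filter_upwards [Ioo_mem_nhdsGT (show s < b from hb)] with u hu
  have := nhdsLT_neBot_of_pos (zero_le.trans_lt hu.1)
  refine lt_of_le_of_lt (le_of_tendsto ((hψ.tendsto_leftLim u).dist tendsto_const_nhds)
    (b := η / 2) ?_) (half_lt_self hη)
  filter_upwards [Ioo_mem_nhdsLT hu.1] with r hr
  exact (hsub ⟨hr.1, hr.2.trans hu.2⟩).le

/-- The right derivative of the time integral of the left limits of a càdlàg path is the path. -/
theorem IsCadlag.tendsto_slope_timeIntegral {ψ : ℝ≥0 → ℝ} (hψ : IsCadlag ψ) (s : ℝ≥0) :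
    Tendsto (fun n : ℕ => ((n : ℝ) + 1) *
      ∫ u in (s : ℝ)..(s + 1 / ((n : ℝ≥0) + 1) : ℝ≥0), Function.leftLim ψ u.toNNReal)
      atTop (𝓝 (ψ s)) := by
  rw [Metric.tendsto_nhds]
  intro η hη
  have h1 : ∀ᶠ u in 𝓝[>] s, dist (Function.leftLim ψ u) (ψ s) < η / 2 :=
    Metric.tendsto_nhds.1 (hψ.tendsto_leftLim_right s) _ (half_pos hη)
  obtain ⟨b, hb, hsub⟩ := (mem_nhdsGT_iff_exists_Ioo_subset' (lt_add_one s)).1 h1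
  have h2 : Tendsto (fun n : ℕ => s + 1 / ((n : ℝ≥0) + 1)) atTop (𝓝 s) := by
    simpa using (tendsto_const_nhds (x := s)).add
      (tendsto_one_div_add_atTop_nhds_zero_nat (𝕜 := ℝ≥0))
  filter_upwards [h2.eventually (gt_mem_nhds (show s < b from hb))] with n hn
  have hn1 : (0 : ℝ) < (n : ℝ) + 1 := by positivity
  have hle : s ≤ s + 1 / ((n : ℝ≥0) + 1) := le_self_add
  have hlen : (((s + 1 / ((n : ℝ≥0) + 1) : ℝ≥0) : ℝ) - s) = 1 / ((n : ℝ) + 1) := by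
    push_cast; ring
  have h3 := intervalIntegral.norm_integral_le_of_norm_le_const (a := (s : ℝ))
    (b := ((s + 1 / ((n : ℝ≥0) + 1) : ℝ≥0) : ℝ)) (C := η / 2)
    (f := fun u => Function.leftLim ψ u.toNNReal - ψ s) fun u hu => by
      rw [uIoc_of_le (NNReal.coe_le_coe.2 hle)] at hu
      exact (hsub ⟨Real.lt_toNNReal_iff_coe_lt.2 hu.1,
        (Real.toNNReal_le_iff_le_coe.2 hu.2).trans_lt hn⟩).le
  rw [intervalIntegral.integral_sub (hψ.intervalIntegrable_leftLim _ _) (by simp),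
    intervalIntegral.integral_const, hlen, abs_of_pos (by positivity), smul_eq_mul] at h3
  rw [Real.dist_eq]
  set J := ∫ u in (s : ℝ)..(s + 1 / ((n : ℝ≥0) + 1) : ℝ≥0), Function.leftLim ψ u.toNNReal
  have h4 : ((n : ℝ) + 1) * J - ψ s = ((n : ℝ) + 1) * (J - 1 / ((n : ℝ) + 1) * ψ s) := by
    field_simp
  rw [h4, abs_mul, abs_of_pos hn1]
  calc ((n : ℝ) + 1) * |J - 1 / ((n : ℝ) + 1) * ψ s|
      ≤ ((n : ℝ) + 1) * (η / 2 * (1 / ((n : ℝ) + 1))) :=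
        mul_le_mul_of_nonneg_left h3 hn1.le
    _ = η / 2 := by field_simp
    _ < η := half_lt_self hη

/-! ### The state equation along a path -/

section StateEquation

variable {p q : ℕ}

/-- The observables `a' Bʲ y` of a state `y`. Together they determine the future volatility, and
unlike `y` itself they can be read off from the volatility process. -/
def obs (κ : CogarchParam p q) (j : ℕ) (y : Fin q → ℝ) : ℝ :=
  κ.a ⬝ᵥ ((κ.B ^ j).mulVec y)

theorem continuous_obs (κ : CogarchParam p q) (j : ℕ) : Continuous (obs κ j) := by
  unfold obs; fun_prop

/-- The path `y` solves the state equation driven by the path `x`. -/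
def SolvesPathwise (κ : CogarchParam p q) (x : ℝ≥0 → ℝ) (y : ℝ≥0 → Fin q → ℝ) : Prop :=
  ∀ (t : ℝ≥0) (i : Fin q), y t i = y 0 i
      + (∫ u in (0 : ℝ)..t, (κ.B.mulVec (Function.leftLim y u.toNNReal)) i)
      + κ.e i * stieltjesIntegral (fun u => κ.α 0 + κ.a ⬝ᵥ Function.leftLim y u)
          (quadraticVariation x) 0 t

section Pathwise

variable {κ : CogarchParam p q} {x : ℝ≥0 → ℝ} {y : ℝ≥0 → Fin q → ℝ}

theorem IsCadlag.mulVec_apply (hy : IsCadlag y) (M : Matrix (Fin q) (Fin q) ℝ) (i : Fin q) :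
    IsCadlag fun t => (M.mulVec (y t)) i :=
  hy.comp (φ := fun v => (M.mulVec v) i) (by fun_prop)

theorem IsCadlag.affine (hy : IsCadlag y) (α : ℝ) (a : Fin q → ℝ) :
    IsCadlag fun t => α + a ⬝ᵥ y t :=
  hy.comp (φ := fun v => α + a ⬝ᵥ v) (by fun_prop)

theorem IsCadlag.obs (hy : IsCadlag y) (κ : CogarchParam p q) (j : ℕ) :
    IsCadlag fun t => obs κ j (y t) :=
  hy.comp (continuous_obs κ j)

theorem SolvesPathwise.sub (h : SolvesPathwise κ x y) (hx : IsFV x) (hy : IsCadlag y)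
    {c d : ℝ≥0} (hcd : c ≤ d) (i : Fin q) :
    y d i - y c i = (∫ u in (c : ℝ)..d,
        Function.leftLim (fun s => (κ.B.mulVec (y s)) i) u.toNNReal)
      + κ.e i * stieltjesIntegral (Function.leftLim fun s => κ.α 0 + κ.a ⬝ᵥ y s)
          (quadraticVariation x) c d := by
  have h1 : ∀ u, Function.leftLim (fun s => (κ.B.mulVec (y s)) i) u
      = (κ.B.mulVec (Function.leftLim y u)) i :=
    hy.leftLim_comp (φ := fun v => (κ.B.mulVec v) i) (by fun_prop)
  have h2 : (Function.leftLim fun s => κ.α 0 + κ.a ⬝ᵥ y s)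
      = fun u => κ.α 0 + κ.a ⬝ᵥ Function.leftLim y u :=
    funext (hy.leftLim_comp (φ := fun v => κ.α 0 + κ.a ⬝ᵥ v) (by fun_prop))
  have h3 := hx.isFV_quadraticVariation.stieltjesIntegral_add (hy.affine (κ.α 0) κ.a)
    (zero_le (a := c)) hcd
  have h4 := (hy.mulVec_apply κ.B i).intervalIntegrable_leftLim
  have h5 := intervalIntegral.integral_add_adjacent_intervals (h4 0 c) (h4 c d)
  rw [NNReal.coe_zero] at h5
  simp only [h1] at h5 ⊢
  rw [h d i, h c i, ← h2, ← h3, ← h5]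
  ring

/-- One step of the Euler scheme has an error that is controlled by oscillations. -/
theorem SolvesPathwise.abs_euler_step_le (h : SolvesPathwise κ x y) (hx : IsFV x)
    (hy : IsCadlag y) {c d T : ℝ≥0} (hcd : c ≤ d) (hd : d ≤ T) {C : ℝ}
    (hC : |κ.α 0 + κ.a ⬝ᵥ y c| ≤ C) (i : Fin q) :
    |y d i - (y c i + ((d : ℝ) - c) * (κ.B.mulVec (y c)) i
        + κ.e i * ((κ.α 0 + κ.a ⬝ᵥ y c) * (x d - x c) ^ 2))|
      ≤ (∫ u in Ioc c d, |Function.leftLim (fun s => (κ.B.mulVec (y s)) i) u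
            - (κ.B.mulVec (y c)) i| ∂(lebesgueTo T))
        + (∫ u in Ioc c d, |Function.leftLim (fun s => κ.α 0 + κ.a ⬝ᵥ y s) u
            - (κ.α 0 + κ.a ⬝ᵥ y c)| ∂(hx.isFV_quadraticVariation.totalVariation T))
        + 2 * C * ∫ u in Ioc c d, |Function.leftLim x u - x c| ∂(hx.totalVariation T) := by
  have hC0 : 0 ≤ C := (abs_nonneg _).trans hC
  have h0 := h.sub hx hy hcd i
  have h1 := (hy.mulVec_apply κ.B i).abs_timeIntegral_sub_le hcd hd
  have h2 := hx.isFV_quadraticVariation.abs_stieltjesIntegral_sub_le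
    (hy.affine (κ.α 0) κ.a) hcd hd
  have h3 := hx.abs_quadraticVariation_sub_le hcd hd
  have he : |κ.e i| ≤ 1 := by
    unfold CogarchParam.e; split_ifs <;> simp
  set I1 := ∫ u in (c : ℝ)..d, Function.leftLim (fun s => (κ.B.mulVec (y s)) i) u.toNNReal
  set I2 := stieltjesIntegral (Function.leftLim fun s => κ.α 0 + κ.a ⬝ᵥ y s)
          (quadraticVariation x) c d
  set v := κ.α 0 + κ.a ⬝ᵥ y c
  set dA := quadraticVariation x d - quadraticVariation x c
  have h4 : y d i - (y c i + ((d : ℝ) - c) * (κ.B.mulVec (y c)) i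
        + κ.e i * (v * (x d - x c) ^ 2))
      = (I1 - ((d : ℝ) - c) * (κ.B.mulVec (y c)) i)
        + κ.e i * ((I2 - v * dA) + v * (dA - (x d - x c) ^ 2)) := by
    linear_combination h0
  rw [h4]
  have h5 : |v * (dA - (x d - x c) ^ 2)|
      ≤ 2 * C * ∫ u in Ioc c d, |Function.leftLim x u - x c| ∂(hx.totalVariation T) := by
    rw [abs_mul]
    refine (mul_le_mul hC h3 (abs_nonneg _) hC0).trans_eq (by ring)
  have h6 : |κ.e i * ((I2 - v * dA) + v * (dA - (x d - x c) ^ 2))|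
      ≤ |I2 - v * dA| + |v * (dA - (x d - x c) ^ 2)| := by
    rw [abs_mul]
    exact (mul_le_of_le_one_left (abs_nonneg _) he).trans (abs_add_le _ _)
  have h7 := abs_add_le (I1 - ((d : ℝ) - c) * (κ.B.mulVec (y c)) i)
    (κ.e i * ((I2 - v * dA) + v * (dA - (x d - x c) ^ 2)))
  linarith

end Pathwise

/-! ### Convergence of the Euler scheme -/

theorem discrete_gronwall_bound {ε b ρ : ℕ → ℝ} (h0 : ε 0 = 0) (n : ℕ)
    (hb : ∀ i < n, 0 ≤ b i) (hρ : ∀ i < n, 0 ≤ ρ i)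
    (h : ∀ i < n, ε (i + 1) ≤ (1 + b i) * ε i + ρ i) :
    ε n ≤ Real.exp (∑ i ∈ Finset.range n, b i) * ∑ i ∈ Finset.range n, ρ i := by
  induction n with
  | zero => simp [h0]
  | succ n ih =>
    have ih := ih (fun i hi => hb i (by omega)) (fun i hi => hρ i (by omega))
      fun i hi => h i (by omega)
    have hbn := hb n (by omega)
    have hρn := hρ n (by omega)
    have hS : 0 ≤ ∑ i ∈ Finset.range n, ρ i :=
      Finset.sum_nonneg fun i hi => hρ i (by have := Finset.mem_range.1 hi; omega)
    have hE : 0 ≤ ∑ i ∈ Finset.range n, b i :=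
      Finset.sum_nonneg fun i hi => hb i (by have := Finset.mem_range.1 hi; omega)
    rw [Finset.sum_range_succ, Finset.sum_range_succ, Real.exp_add]
    have h1 : 1 + b n ≤ Real.exp (b n) := by linarith [Real.add_one_le_exp (b n)]
    have h2 : (1 + b n) * ε n ≤ Real.exp (b n) *
        (Real.exp (∑ i ∈ Finset.range n, b i) * ∑ i ∈ Finset.range n, ρ i) :=
      (mul_le_mul_of_nonneg_left ih (by linarith)).trans
        (mul_le_mul_of_nonneg_right h1 (by positivity))
    have h3 : ρ n ≤ Real.exp (∑ i ∈ Finset.range n, b i) * Real.exp (b n) * ρ n := by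
      refine le_mul_of_one_le_left hρn ?_
      rw [← Real.exp_add]
      exact Real.one_le_exp (by linarith)
    have := h n (by omega)
    linarith

/-- The Euler scheme with time step `δ` for the state equation, driven by the increments `dx`. -/
def euler (κ : CogarchParam p q) (δ : ℝ) (dx : ℕ → ℝ) (y : Fin q → ℝ) : ℕ → Fin q → ℝ
  | 0 => y
  | i + 1 => euler κ δ dx y i + δ • κ.B.mulVec (euler κ δ dx y i)
      + ((κ.α 0 + κ.a ⬝ᵥ euler κ δ dx y i) * dx i ^ 2) • κ.e

/-- The Euler scheme in terms of the observables; it needs no knowledge of the state. -/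
def obsEuler (κ : CogarchParam p q) (δ : ℝ) (dx : ℕ → ℝ) (w : ℕ → ℝ) : ℕ → ℕ → ℝ
  | 0 => w
  | i + 1 => fun j => obsEuler κ δ dx w i j + δ * obsEuler κ δ dx w i (j + 1)
      + ((κ.α 0 + obsEuler κ δ dx w i 0) * dx i ^ 2) * obs κ j κ.e

theorem obs_euler (κ : CogarchParam p q) (δ : ℝ) (dx : ℕ → ℝ) (y : Fin q → ℝ) (i j : ℕ) :
    obs κ j (euler κ δ dx y i) = obsEuler κ δ dx (fun j => obs κ j y) i j := by
  induction i generalizing j with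
  | zero => rfl
  | succ i ih =>
    have h0 := ih 0
    simp only [obsEuler]
    rw [← ih j, ← ih (j + 1), ← h0, euler]
    simp only [obs, Matrix.mulVec_add, Matrix.mulVec_smul, dotProduct_add, dotProduct_smul,
      Matrix.mulVec_mulVec, pow_succ, smul_eq_mul, pow_zero, Matrix.one_mulVec]

theorem abs_dotProduct_le (a v : Fin q → ℝ) : |a ⬝ᵥ v| ≤ (∑ i, |a i|) * ‖v‖ := by
  rw [dotProduct, Finset.sum_mul]
  refine (Finset.abs_sum_le_sum_abs _ _).trans (Finset.sum_le_sum fun i _ => ?_)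
  rw [abs_mul]
  exact mul_le_mul_of_nonneg_left (norm_le_pi_norm v i) (abs_nonneg _)

theorem norm_mulVec_le (M : Matrix (Fin q) (Fin q) ℝ) (v : Fin q → ℝ) :
    ‖M.mulVec v‖ ≤ (∑ i, ∑ j, |M i j|) * ‖v‖ := by
  refine (pi_norm_le_iff_of_nonneg (by positivity)).2 fun i => ?_
  refine (abs_dotProduct_le (M i) v).trans (mul_le_mul_of_nonneg_right ?_ (norm_nonneg _))
  exact Finset.single_le_sum (f := fun i => ∑ j, |M i j|)
    (fun i _ => Finset.sum_nonneg fun j _ => abs_nonneg _) (Finset.mem_univ i)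

/-- The local errors of the Euler scheme are bounded by oscillations, whose sum tends to zero, and
the discrete Gronwall inequality sums them up: the growth rates `K (δ + dx²)` of the scheme have
bounded sum because the driving path has finite variation. -/
theorem SolvesPathwise.tendsto_euler {κ : CogarchParam p q} {x : ℝ≥0 → ℝ}
    {y : ℝ≥0 → Fin q → ℝ} (h : SolvesPathwise κ x y) (hx : IsFV x) (hy : IsCadlag y)
    (t L : ℝ≥0) :
    Tendsto (fun n : ℕ => euler κ (L / n) (fun i => x (t + L / n * (i + 1 : ℕ))
      - x (t + L / n * i)) (y t) n) atTop (𝓝 (y (t + L))) := by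
  set T := t + L with hT
  obtain ⟨C, hC0, hC⟩ := (hy.affine (κ.α 0) κ.a).exists_bound T
  set m := hx.totalVariation T
  set K := (∑ i, |κ.a i|) + ∑ i, ∑ j, |κ.B i j| with hK
  have hK0 : 0 ≤ K := by positivity
  have he : ‖κ.e‖ ≤ 1 := by
    refine (pi_norm_le_iff_of_nonneg zero_le_one).2 fun i => ?_
    unfold CogarchParam.e; split_ifs <;> simp
  -- `ρ n i` dominates the local error of the `i`-th step.
  let ρ : ℕ → ℕ → ℝ := fun n i =>
    (∑ k : Fin q, ∫ u in Ioc (t + L / n * i) (t + L / n * (i + 1 : ℕ)),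
      |Function.leftLim (fun s => (κ.B.mulVec (y s)) k) u
        - (κ.B.mulVec (y (t + L / n * i))) k| ∂(lebesgueTo T))
    + (∫ u in Ioc (t + L / n * i) (t + L / n * (i + 1 : ℕ)),
      |Function.leftLim (fun s => κ.α 0 + κ.a ⬝ᵥ y s) u
        - (κ.α 0 + κ.a ⬝ᵥ y (t + L / n * i))| ∂(hx.isFV_quadraticVariation.totalVariation T))
    + 2 * C * ∫ u in Ioc (t + L / n * i) (t + L / n * (i + 1 : ℕ)),
      |Function.leftLim x u - x (t + L / n * i)| ∂m
  have hρ0 : ∀ n i, 0 ≤ ρ n i := fun n i => by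
    have h1 : ∀ (f : ℝ≥0 → ℝ) (μ : Measure ℝ≥0), 0 ≤ ∫ u, |f u| ∂μ := fun f μ =>
      integral_nonneg fun _ => abs_nonneg _
    exact add_nonneg (add_nonneg (Finset.sum_nonneg fun k _ => h1 _ _) (h1 _ _))
      (mul_nonneg (by positivity) (h1 _ _))
  have hρ : Tendsto (fun n : ℕ => ∑ i ∈ Finset.range n, ρ n i) atTop (𝓝 0) := by
    have h1 := tendsto_finsetSum Finset.univ fun (k : Fin q) _ =>
      (hy.mulVec_apply κ.B k).tendsto_sum_integral_oscillation (lebesgueTo T) t L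
    have h2 := (hy.affine (κ.α 0) κ.a).tendsto_sum_integral_oscillation
      (hx.isFV_quadraticVariation.totalVariation T) t L
    have h3 := (hx.cadlag.tendsto_sum_integral_oscillation m t L).const_mul (2 * C)
    have h4 := (h1.add h2).add h3
    simp only [Finset.sum_const_zero, add_zero, mul_zero] at h4
    refine h4.congr fun n => ?_
    simp only [ρ]
    rw [Finset.sum_add_distrib, Finset.sum_add_distrib, Finset.sum_comm, Finset.mul_sum]
  have hmain : ∀ᶠ n : ℕ in atTop, dist (euler κ (L / n) (fun i => x (t + L / n * (i + 1 : ℕ))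
      - x (t + L / n * i)) (y t) n) (y T)
      ≤ Real.exp (K * (L + m.real univ ^ 2)) * ∑ i ∈ Finset.range n, ρ n i := by
    filter_upwards [eventually_gt_atTop 0] with n hn
    set s : ℕ → ℝ≥0 := fun i => t + L / n * i with hs
    have hmono : Monotone s := fun i j hij => by simp only [hs]; gcongr
    have hend : s n = T := by
      simp only [hs, hT]
      rw [div_mul_cancel₀]; exact_mod_cast hn.ne'
    have hstep : ∀ i, ((s (i + 1) : ℝ≥0) : ℝ) - s i = L / n := fun i => by
      simp only [hs]; push_cast; ring
    set dx : ℕ → ℝ := fun i => x (s (i + 1)) - x (s i) with hdx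
    change dist (euler κ (L / n) dx (y t) n) (y T) ≤ _
    have hsT : ∀ i ≤ n, s i ≤ T := fun i hi => hend ▸ hmono hi
    have hs0 : s 0 = t := by simp [hs]
    have hdx1 : ∀ i < n, |dx i| ≤ m.real (Ioc (s i) (s (i + 1))) := fun i hi =>
      hx.abs_sub_le T (hmono (Nat.le_succ i)) (hsT _ hi)
    have hdx2 : ∑ i ∈ Finset.range n, dx i ^ 2 ≤ m.real univ ^ 2 := by
      have h1 : ∑ i ∈ Finset.range n, |dx i| ≤ m.real univ := by
        have h2 : ∀ k ≤ n, ∑ i ∈ Finset.range k, |dx i| ≤ m.real (Ioc t (s k)) := by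
          intro k hk
          induction k with
          | zero => simp [hs]
          | succ k ih =>
            rw [Finset.sum_range_succ, ← Ioc_union_Ioc_eq_Ioc (hs0 ▸ hmono (Nat.zero_le k))
              (hmono (Nat.le_succ k)), measureReal_union (Ioc_disjoint_Ioc_of_le le_rfl)
              measurableSet_Ioc]
            exact add_le_add (ih (by omega)) (hdx1 k (by omega))
        exact (h2 n le_rfl).trans (measureReal_mono (subset_univ _))
      calc ∑ i ∈ Finset.range n, dx i ^ 2
          ≤ ∑ i ∈ Finset.range n, m.real univ * |dx i| := Finset.sum_le_sum fun i hi => by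
            rw [← sq_abs, sq]
            exact mul_le_mul_of_nonneg_right ((hdx1 i (Finset.mem_range.1 hi)).trans
              (measureReal_mono (subset_univ _))) (abs_nonneg _)
        _ ≤ m.real univ ^ 2 := by
            rw [← Finset.mul_sum, sq]
            exact mul_le_mul_of_nonneg_left h1 measureReal_nonneg
    set E := euler κ (L / n) dx (y t) with hE
    have hrec : ∀ i < n, ‖y (s (i + 1)) - E (i + 1)‖
        ≤ (1 + K * (L / n + dx i ^ 2)) * ‖y (s i) - E i‖ + ρ n i := by
      intro i hi
      set z := y (s i) - E i with hz
      set r := y (s (i + 1)) - (y (s i) + ((L : ℝ) / n) • κ.B.mulVec (y (s i))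
        + ((κ.α 0 + κ.a ⬝ᵥ y (s i)) * dx i ^ 2) • κ.e) with hr
      have h1 : y (s (i + 1)) - E (i + 1) = z + ((L : ℝ) / n) • κ.B.mulVec z
          + ((κ.a ⬝ᵥ z) * dx i ^ 2) • κ.e + r := by
        have : E (i + 1) = E i + ((L : ℝ) / n) • κ.B.mulVec (E i)
          + ((κ.α 0 + κ.a ⬝ᵥ E i) * dx i ^ 2) • κ.e := rfl
        rw [hr, this, hz, Matrix.mulVec_sub, dotProduct_sub]
        module
      have h2 : ‖r‖ ≤ ρ n i := by
        refine (pi_norm_le_iff_of_nonneg (hρ0 n i)).2 fun k => ?_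
        have h3 := h.abs_euler_step_le hx hy (hmono (Nat.le_succ i)) (hsT _ hi)
          (hC _ (hsT i hi.le)) k
        rw [hstep] at h3
        have h4 : r k = y (s (i + 1)) k - (y (s i) k + ((L : ℝ) / n) * (κ.B.mulVec (y (s i))) k
            + κ.e k * ((κ.α 0 + κ.a ⬝ᵥ y (s i)) * (x (s (i + 1)) - x (s i)) ^ 2)) := by
          simp only [hr, hdx, Pi.sub_apply, Pi.add_apply, Pi.smul_apply, smul_eq_mul]
          ring
        rw [h4]
        refine h3.trans ?_
        refine add_le_add_left (add_le_add_left ?_ _) _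
        exact Finset.single_le_sum (f := fun k : Fin q =>
          ∫ u in Ioc (s i) (s (i + 1)), |Function.leftLim (fun s => (κ.B.mulVec (y s)) k) u
            - (κ.B.mulVec (y (s i))) k| ∂(lebesgueTo T))
          (fun k _ => integral_nonneg fun _ => abs_nonneg _) (Finset.mem_univ k)
      have hA : (0 : ℝ) ≤ ∑ i, |κ.a i| := Finset.sum_nonneg fun _ _ => abs_nonneg _
      have hB : (0 : ℝ) ≤ ∑ i, ∑ j, |κ.B i j| :=
        Finset.sum_nonneg fun _ _ => Finset.sum_nonneg fun _ _ => abs_nonneg _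
      have h5 : ‖((L : ℝ) / n) • κ.B.mulVec z‖ ≤ K * (L / n) * ‖z‖ := by
        rw [norm_smul, Real.norm_of_nonneg (by positivity)]
        calc (L : ℝ) / n * ‖κ.B.mulVec z‖ ≤ L / n * (K * ‖z‖) := by
              gcongr
              exact (norm_mulVec_le _ _).trans (by gcongr; linarith)
          _ = _ := by ring
      have h6 : ‖((κ.a ⬝ᵥ z) * dx i ^ 2) • κ.e‖ ≤ K * dx i ^ 2 * ‖z‖ := by
        rw [norm_smul, Real.norm_eq_abs, abs_mul, abs_of_nonneg (sq_nonneg (dx i))]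
        calc |κ.a ⬝ᵥ z| * dx i ^ 2 * ‖κ.e‖ ≤ |κ.a ⬝ᵥ z| * dx i ^ 2 * 1 := by gcongr
          _ ≤ (K * ‖z‖) * dx i ^ 2 * 1 := by
              gcongr
              exact (abs_dotProduct_le _ _).trans (by gcongr; linarith)
          _ = _ := by ring
      rw [h1]
      have h7 := norm_add_le (z + ((L : ℝ) / n) • κ.B.mulVec z
          + ((κ.a ⬝ᵥ z) * dx i ^ 2) • κ.e) r
      have h8 := norm_add₃_le (a := z) (b := ((L : ℝ) / n) • κ.B.mulVec z)
        (c := ((κ.a ⬝ᵥ z) * dx i ^ 2) • κ.e)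
      linarith
    have hG := discrete_gronwall_bound (ε := fun i => ‖y (s i) - E i‖)
      (b := fun i => K * (L / n + dx i ^ 2)) (ρ := ρ n) (by simp [hs0, hE, euler]) n
      (fun i _ => by positivity) (fun i _ => hρ0 n i) hrec
    rw [dist_comm, dist_eq_norm, ← hend]
    refine hG.trans (mul_le_mul_of_nonneg_right (Real.exp_le_exp.2 ?_)
      (Finset.sum_nonneg fun i _ => hρ0 n i))
    rw [← Finset.mul_sum, Finset.sum_add_distrib]
    refine mul_le_mul_of_nonneg_left (add_le_add ?_ hdx2) hK0
    rw [Finset.sum_const, Finset.card_range, nsmul_eq_mul, mul_div_cancel₀]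
    exact_mod_cast hn.ne'
  rw [tendsto_iff_dist_tendsto_zero]
  refine squeeze_zero' (Eventually.of_forall fun _ => dist_nonneg) hmain ?_
  simpa using hρ.const_mul _

/-- The observables at time `t + L`, as a functional of those at time `t` and of the driving path
after `t`. -/
def flow (κ : CogarchParam p q) (L : ℝ≥0) (w : ℕ → ℝ) (g : ℝ≥0 → ℝ) (j : ℕ) : ℝ :=
  limsup (fun n : ℕ => obsEuler κ (L / n) (fun i => g (L / n * (i + 1 : ℕ)) - g (L / n * i)) w n j)
    atTop

theorem SolvesPathwise.obs_eq_flow {κ : CogarchParam p q} {x : ℝ≥0 → ℝ}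
    {y : ℝ≥0 → Fin q → ℝ} (h : SolvesPathwise κ x y) (hx : IsFV x) (hy : IsCadlag y)
    (t L : ℝ≥0) (j : ℕ) :
    obs κ j (y (t + L))
      = flow κ L (fun j => obs κ j (y t)) (fun u => x (t + u) - x t) j := by
  have h1 := ((continuous_obs κ j).tendsto _).comp (h.tendsto_euler hx hy t L)
  rw [flow, ← h1.limsup_eq]
  congr 1
  ext n
  simp only [Function.comp_apply, obs_euler, sub_sub_sub_cancel_right]

theorem measurable_obsEuler (κ : CogarchParam p q) (δ : ℝ) (i j : ℕ) :
    Measurable fun z : (ℕ → ℝ) × (ℕ → ℝ) => obsEuler κ δ z.1 z.2 i j := by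
  induction i generalizing j with
  | zero => exact (measurable_pi_apply j).comp measurable_snd
  | succ i ih =>
    have h1 := ih j
    have h2 := ih (j + 1)
    have h3 := ih 0
    have h4 : Measurable fun z : (ℕ → ℝ) × (ℕ → ℝ) => z.1 i :=
      (measurable_pi_apply i).comp measurable_fst
    simp only [obsEuler]
    fun_prop

theorem measurable_flow (κ : CogarchParam p q) (L : ℝ≥0) (j : ℕ) :
    Measurable fun z : (ℕ → ℝ) × (ℝ≥0 → ℝ) => flow κ L z.1 z.2 j := by
  refine Measurable.limsup fun n => ?_
  have h : Measurable fun z : (ℕ → ℝ) × (ℝ≥0 → ℝ) =>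
      ((fun i : ℕ => z.2 (L / n * (i + 1 : ℕ)) - z.2 (L / n * i)), z.1) := by
    refine Measurable.prodMk (measurable_pi_lambda _ fun i => ?_) measurable_fst
    exact ((measurable_pi_apply _).comp measurable_snd).sub
      ((measurable_pi_apply _).comp measurable_snd)
  exact (measurable_obsEuler κ (L / n) n j).comp h

/-! ### Reading the observables off the volatility -/

/-- A continuous path of finite variation has no quadratic variation. -/
theorem IsFV.quadraticVariation_eq_of_continuousOn {x : ℝ≥0 → ℝ} (hx : IsFV x) {c d : ℝ≥0}
    (hcd : c ≤ d) (hc : ContinuousOn x (Icc c d)) :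
    quadraticVariation x d = quadraticVariation x c := by
  obtain ⟨L, rfl⟩ := exists_add_of_le hcd
  refine sub_eq_zero.1 (tendsto_nhds_unique (hx.tendsto_sum_sq c L) ?_)
  set M := (hx.totalVariation (c + L)).real univ with hM
  have hM0 : 0 ≤ M := measureReal_nonneg
  rw [Metric.tendsto_nhds]
  intro η hη
  have huc := isCompact_Icc.uniformContinuousOn_of_continuous hc
  obtain ⟨δ, hδ, hunif⟩ := Metric.uniformContinuousOn_iff.1 huc (η / (M + 1)) (by positivity)
  have hδ0 : Tendsto (fun n : ℕ => L / (n : ℝ≥0)) atTop (𝓝 0) :=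
    tendsto_const_div_atTop_nhds_zero_nat L
  have hδ1 : ∀ᶠ n : ℕ in atTop, L / (n : ℝ≥0) < δ.toNNReal :=
    hδ0.eventually (gt_mem_nhds (Real.toNNReal_pos.2 hδ))
  filter_upwards [hδ1, eventually_gt_atTop 0] with n hn1 hn
  set s : ℕ → ℝ≥0 := fun i => c + L / n * i with hs
  have hmono : Monotone s := fun i j hij => by simp only [hs]; gcongr
  have hend : s n = c + L := by
    simp only [hs]
    rw [div_mul_cancel₀]; exact_mod_cast hn.ne'
  have hs0 : s 0 = c := by simp [hs]
  have hmem : ∀ i ≤ n, s i ∈ Icc c (c + L) := fun i hi =>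
    ⟨hs0 ▸ hmono (Nat.zero_le i), hend ▸ hmono hi⟩
  have hsmall : ∀ i < n, |x (s (i + 1)) - x (s i)| ≤ η / (M + 1) := fun i hi => by
    refine (hunif _ (hmem _ hi) _ (hmem _ hi.le) ?_).le
    have h1 : s (i + 1) = s i + L / n := by simp only [hs]; push_cast; ring
    rw [h1, NNReal.dist_eq, NNReal.coe_add, add_sub_cancel_left,
      abs_of_nonneg (NNReal.coe_nonneg _)]
    exact Real.lt_toNNReal_iff_coe_lt.1 hn1
  have hvar : ∀ k ≤ n, ∑ i ∈ Finset.range k, |x (s (i + 1)) - x (s i)|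
      ≤ (hx.totalVariation (c + L)).real (Ioc c (s k)) := by
    intro k hk
    induction k with
    | zero => simp
    | succ k ih =>
      rw [Finset.sum_range_succ, ← Ioc_union_Ioc_eq_Ioc (hmem k (by omega)).1
        (hmono (Nat.le_succ k)), measureReal_union (Ioc_disjoint_Ioc_of_le le_rfl)
        measurableSet_Ioc]
      exact add_le_add (ih (by omega))
        (hx.abs_sub_le _ (hmono (Nat.le_succ k)) (hmem _ hk).2)
  have hsum : ∑ i ∈ Finset.range n, (x (s (i + 1)) - x (s i)) ^ 2 ≤ η / (M + 1) * M := by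
    calc _ ≤ ∑ i ∈ Finset.range n, η / (M + 1) * |x (s (i + 1)) - x (s i)| :=
          Finset.sum_le_sum fun i hi => by
            rw [← sq_abs, sq]
            exact mul_le_mul_of_nonneg_right (hsmall i (Finset.mem_range.1 hi)) (abs_nonneg _)
      _ ≤ _ := by
          rw [← Finset.mul_sum]
          exact mul_le_mul_of_nonneg_left ((hvar n le_rfl).trans
            (measureReal_mono (subset_univ _))) (by positivity)
  rw [Real.dist_eq, sub_zero, abs_of_nonneg (Finset.sum_nonneg fun _ _ => sq_nonneg _)]
  refine hsum.trans_lt ?_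
  rw [div_mul_eq_mul_div, div_lt_iff₀ (by positivity)]
  nlinarith

theorem SolvesPathwise.obs_sub_of_continuousOn {κ : CogarchParam p q} {x : ℝ≥0 → ℝ}
    {y : ℝ≥0 → Fin q → ℝ} (h : SolvesPathwise κ x y) (hx : IsFV x) (hy : IsCadlag y)
    {c d : ℝ≥0} (hcd : c ≤ d) (hc : ContinuousOn x (Icc c d)) (j : ℕ) :
    obs κ j (y d) - obs κ j (y c)
      = ∫ u in (c : ℝ)..d, Function.leftLim (fun s => obs κ (j + 1) (y s)) u.toNNReal := by
  have hA : stieltjesIntegral (Function.leftLim fun s => κ.α 0 + κ.a ⬝ᵥ y s)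
      (quadraticVariation x) c d = 0 := by
    obtain ⟨L, rfl⟩ := exists_add_of_le hcd
    refine tendsto_nhds_unique (hx.isFV_quadraticVariation.tendsto_riemannSum
      (hy.affine (κ.α 0) κ.a) c L) ?_
    refine tendsto_const_nhds.congr' ?_
    filter_upwards [eventually_gt_atTop 0] with n hn
    have hmono : Monotone fun i : ℕ => c + L / n * (i : ℝ≥0) := fun i j hij => by
      dsimp only; gcongr
    have hend : c + L / n * (n : ℝ≥0) = c + L := by
      rw [div_mul_cancel₀]; exact_mod_cast hn.ne'
    have hconst : ∀ i ≤ n, quadraticVariation x (c + L / n * i) = quadraticVariation x c :=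
      fun i hi => hx.quadraticVariation_eq_of_continuousOn le_self_add
        (hc.mono (Icc_subset_Icc_right (hend ▸ hmono hi)))
    refine (Finset.sum_eq_zero fun i hi => ?_).symm
    have hi := Finset.mem_range.1 hi
    rw [hconst i hi.le, hconst (i + 1) hi, sub_self, mul_zero]
  have hinc : ∀ i, y d i - y c i
      = ∫ u in (c : ℝ)..d, Function.leftLim (fun s => (κ.B.mulVec (y s)) i) u.toNNReal := by
    intro i
    rw [h.sub hx hy hcd i, hA, mul_zero, add_zero]
  have hlin : ∀ v : Fin q → ℝ, obs κ j v = ∑ i, (Matrix.vecMul κ.a (κ.B ^ j)) i * v i := by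
    intro v
    rw [obs, Matrix.dotProduct_mulVec]; rfl
  have hlin1 : ∀ v : Fin q → ℝ, obs κ (j + 1) v = obs κ j (κ.B.mulVec v) := by
    intro v
    rw [obs, obs, Matrix.mulVec_mulVec, pow_succ]
  have hleft : ∀ u, Function.leftLim (fun s => obs κ (j + 1) (y s)) u
      = ∑ i, (Matrix.vecMul κ.a (κ.B ^ j)) i
          * Function.leftLim (fun s => (κ.B.mulVec (y s)) i) u := by
    intro u
    rw [hy.leftLim_comp (continuous_obs κ (j + 1)), hlin1, hlin]
    refine Finset.sum_congr rfl fun i _ => ?_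
    rw [hy.leftLim_comp (φ := fun v => (κ.B.mulVec v) i) (by fun_prop)]
  simp only [hleft]
  rw [intervalIntegral.integral_finsetSum fun i _ =>
    ((hy.mulVec_apply κ.B i).intervalIntegrable_leftLim c d).const_mul _]
  rw [hlin, hlin, ← Finset.sum_sub_distrib]
  refine Finset.sum_congr rfl fun i _ => ?_
  rw [intervalIntegral.integral_const_mul, ← hinc i, mul_sub]

/-- Iterated right derivatives of a path, starting from its right limit minus `α`. -/
def germ (α : ℝ) (v : ℝ≥0 → ℝ) : ℕ → ℝ≥0 → ℝ
  | 0 => fun s => limsup (fun n : ℕ => v (s + 1 / ((n : ℝ≥0) + 1)) - α) atTop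
  | j + 1 => fun s => limsup (fun n : ℕ =>
      ((n : ℝ) + 1) * (germ α v j (s + 1 / ((n : ℝ≥0) + 1)) - germ α v j s)) atTop

theorem measurable_germ (α : ℝ) (j : ℕ) (s : ℝ≥0) :
    Measurable fun v : ℝ≥0 → ℝ => germ α v j s := by
  induction j generalizing s with
  | zero => exact Measurable.limsup fun n => (measurable_pi_apply _).sub_const _
  | succ j ih => exact Measurable.limsup fun n => ((ih _).sub (ih s)).const_mul _

theorem tendsto_add_one_div (s : ℝ≥0) :
    Tendsto (fun n : ℕ => s + 1 / ((n : ℝ≥0) + 1)) atTop (𝓝[>] s) := by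
  refine tendsto_nhdsWithin_iff.2 ⟨?_, Eventually.of_forall fun n => ?_⟩
  · simpa using (tendsto_const_nhds (x := s)).add
      (tendsto_one_div_add_atTop_nhds_zero_nat (𝕜 := ℝ≥0))
  · exact lt_add_of_pos_right s (by positivity)

/-- As long as the driving path does not jump, each observable is the right derivative of the
previous one, so that the volatility immediately after `t` determines all observables at `t`. -/
theorem SolvesPathwise.germ_volatility {κ : CogarchParam p q} {x : ℝ≥0 → ℝ}
    {y : ℝ≥0 → Fin q → ℝ} (h : SolvesPathwise κ x y) (hx : IsFV x) (hy : IsCadlag y)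
    {t ε : ℝ≥0} (hc : ContinuousOn x (Ico t (t + ε))) (j : ℕ) (s : ℝ≥0) (hs : s < ε) :
    germ (κ.α 0) (fun u => κ.α 0 + κ.a ⬝ᵥ Function.leftLim y (t + u)) j s
      = obs κ j (y (t + s)) := by
  induction j generalizing s with
  | zero =>
    have h1 := ((hy.obs κ 0).tendsto_leftLim_right (t + s)).comp (tendsto_add_one_div (t + s))
    rw [← h1.limsup_eq]
    simp only [germ]
    refine congrArg (fun f : ℕ → ℝ => limsup f atTop) (funext fun n => ?_)
    rw [Function.comp_apply, hy.leftLim_comp (continuous_obs κ 0), add_assoc, obs, pow_zero,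
      Matrix.one_mulVec, add_sub_cancel_left]
  | succ j ih =>
    have h1 := (hy.obs κ (j + 1)).tendsto_slope_timeIntegral (t + s)
    rw [← h1.limsup_eq]
    simp only [germ]
    refine limsup_congr ?_
    have h2 : ∀ᶠ n : ℕ in atTop, s + 1 / ((n : ℝ≥0) + 1) < ε :=
      ((tendsto_add_one_div s).mono_right nhdsWithin_le_nhds).eventually (gt_mem_nhds hs)
    filter_upwards [h2] with n hn
    rw [ih _ hn, ih _ hs, ← add_assoc, h.obs_sub_of_continuousOn hx hy le_self_add]
    refine hc.mono fun u hu => ⟨le_self_add.trans hu.1, hu.2.trans_lt ?_⟩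
    rw [add_assoc]
    gcongr

/-! ### The increments of the price process -/

/-- `∫_{(h, h + r]} √V dS` as a functional of the observables at time `0` and of the increments of
the driving path since time `0`. -/
def incrementFunctional (κ : CogarchParam p q) (r h : ℝ≥0) (z : (ℕ → ℝ) × (ℝ≥0 → ℝ)) : ℝ :=
  limsup (fun n : ℕ => ∑ i ∈ Finset.range n,
    √(κ.α 0 + flow κ (h + r / n * i) z.1 z.2 0)
      * (z.2 (h + r / n * (i + 1 : ℕ)) - z.2 (h + r / n * i))) atTop

theorem measurable_incrementFunctional (κ : CogarchParam p q) (r h : ℝ≥0) :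
    Measurable (incrementFunctional κ r h) := by
  refine Measurable.limsup fun n => Finset.measurable_sum _ fun i _ => ?_
  exact ((measurable_flow κ _ 0).const_add _).sqrt.mul
    (((measurable_pi_apply _).comp measurable_snd).sub
      ((measurable_pi_apply _).comp measurable_snd))

theorem SolvesPathwise.increment_eq {κ : CogarchParam p q} {x : ℝ≥0 → ℝ}
    {y : ℝ≥0 → Fin q → ℝ} (hsol : SolvesPathwise κ x y) (hx : IsFV x) (hy : IsCadlag y)
    (r t h : ℝ≥0) :
    stieltjesIntegral (fun s => √(κ.α 0 + κ.a ⬝ᵥ Function.leftLim y s)) x (t + h) (t + h + r)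
      = incrementFunctional κ r h
          (fun j => obs κ j (y t), fun u => x (t + u) - x t) := by
  have hφ : IsCadlag fun s => √(κ.α 0 + κ.a ⬝ᵥ y s) :=
    hy.comp (φ := fun v => √(κ.α 0 + κ.a ⬝ᵥ v)) (by fun_prop)
  have hleft : (fun s => √(κ.α 0 + κ.a ⬝ᵥ Function.leftLim y s))
      = Function.leftLim fun s => √(κ.α 0 + κ.a ⬝ᵥ y s) :=
    (funext (hy.leftLim_comp (φ := fun v => √(κ.α 0 + κ.a ⬝ᵥ v)) (by fun_prop))).symm
  rw [hleft, incrementFunctional, ← (hx.tendsto_riemannSum hφ (t + h) r).limsup_eq]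
  congr 1
  ext n
  refine Finset.sum_congr rfl fun i _ => ?_
  rw [← hsol.obs_eq_flow hx hy t _ 0, sub_sub_sub_cancel_right]
  simp only [obs, pow_zero, Matrix.one_mulVec, add_assoc]

end StateEquation

/-! ### Past and future of a Poisson process -/

section Independence

variable {Ω : Type*} {mΩ : MeasurableSpace Ω} {P : Measure Ω}

/-- Regrouping: the hypotheses say that the four variables `a`, `b`, `c`, `d` are independent, so
they may be paired differently. -/
theorem indepFun_prodMk_prodMk_of_indepFun [IsZeroOrProbabilityMeasure P]
    {α β γ δ : Type*} {mα : MeasurableSpace α} {mβ : MeasurableSpace β}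
    {mγ : MeasurableSpace γ} {mδ : MeasurableSpace δ} {a : Ω → α} {b : Ω → β} {c : Ω → γ}
    {d : Ω → δ} (ha : Measurable a) (hb : Measurable b) (hc : Measurable c) (hd : Measurable d)
    (hab : IndepFun a b P) (hcd : IndepFun c d P)
    (h : IndepFun (fun ω => (a ω, b ω)) (fun ω => (c ω, d ω)) P) :
    IndepFun (fun ω => (a ω, c ω)) (fun ω => (b ω, d ω)) P := by
  rw [IndepFun_iff_Indep]
  refine IndepSets.indep (ha.prodMk hc).comap_le (hb.prodMk hd).comap_le
    ((isPiSystem_prod (α := α) (β := γ)).comap fun ω => (a ω, c ω))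
    ((isPiSystem_prod (α := β) (β := δ)).comap fun ω => (b ω, d ω)) ?_ ?_ ?_
  · rw [← generateFrom_prod (α := α) (β := γ), MeasurableSpace.comap_generateFrom]; rfl
  · rw [← generateFrom_prod (α := β) (β := δ), MeasurableSpace.comap_generateFrom]; rfl
  · rw [IndepSets_iff]
    rintro _ _ ⟨_, ⟨A, hA, C, hC, rfl⟩, rfl⟩ ⟨_, ⟨B, hB, D, hD, rfl⟩, rfl⟩
    have hA : MeasurableSet A := hA
    have hB : MeasurableSet B := hB
    have hC : MeasurableSet C := hC
    have hD : MeasurableSet D := hD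
    have h1 := h.measure_inter_preimage_eq_mul (A ×ˢ B) (C ×ˢ D) (hA.prod hB) (hC.prod hD)
    have h2 := hab.measure_inter_preimage_eq_mul A B hA hB
    have h3 := hcd.measure_inter_preimage_eq_mul C D hC hD
    have h4 := (h.comp measurable_fst measurable_fst).measure_inter_preimage_eq_mul A C hA hC
    have h5 := (h.comp measurable_snd measurable_snd).measure_inter_preimage_eq_mul B D hB hD
    have e1 : (fun ω => (a ω, c ω)) ⁻¹' A ×ˢ C ∩ (fun ω => (b ω, d ω)) ⁻¹' B ×ˢ D
        = (fun ω => (a ω, b ω)) ⁻¹' A ×ˢ B ∩ (fun ω => (c ω, d ω)) ⁻¹' C ×ˢ D := by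
      ext ω; simp only [mem_inter_iff, mem_preimage, mem_prod]; tauto
    have e2 : (fun ω => (a ω, b ω)) ⁻¹' A ×ˢ B = a ⁻¹' A ∩ b ⁻¹' B := by
      ext ω; simp
    have e3 : (fun ω => (c ω, d ω)) ⁻¹' C ×ˢ D = c ⁻¹' C ∩ d ⁻¹' D := by
      ext ω; simp
    have e4 : (fun ω => (a ω, c ω)) ⁻¹' A ×ˢ C
        = (Prod.fst ∘ fun ω => (a ω, b ω)) ⁻¹' A ∩ (Prod.fst ∘ fun ω => (c ω, d ω)) ⁻¹' C := by
      ext ω; simp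
    have e5 : (fun ω => (b ω, d ω)) ⁻¹' B ×ˢ D
        = (Prod.snd ∘ fun ω => (a ω, b ω)) ⁻¹' B ∩ (Prod.snd ∘ fun ω => (c ω, d ω)) ⁻¹' D := by
      ext ω; simp
    rw [e1, h1, e2, h2, e3, h3, e4, h4, e5, h5]
    change P (a ⁻¹' A) * P (b ⁻¹' B) * (P (c ⁻¹' C) * P (d ⁻¹' D))
      = P (a ⁻¹' A) * P (c ⁻¹' C) * (P (b ⁻¹' B) * P (d ⁻¹' D))
    ring

end Independence

/-- A finite set of times that contains `0` can be listed by a monotone sequence starting at `0`. -/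
theorem exists_monotone_enumeration (s : Finset ℝ≥0) (h0 : 0 ∈ s) :
    ∃ e : ℕ → ℝ≥0, Monotone e ∧ e 0 = 0 ∧ ∃ n, ∀ x ∈ s, ∃ i ≤ n, e i = x := by
  have hcard : 0 < s.card := Finset.card_pos.2 ⟨0, h0⟩
  let e : ℕ → ℝ≥0 := fun i => s.orderEmbOfFin rfl ⟨min i (s.card - 1), by omega⟩
  have hmono : Monotone e := fun i j hij =>
    (s.orderEmbOfFin rfl).monotone (Fin.mk_le_mk.2 (min_le_min_right _ hij))
  have hsurj : ∀ x ∈ s, ∃ i ≤ s.card, e i = x := by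
    intro x hx
    have : x ∈ Set.range (s.orderEmbOfFin rfl) := by rwa [Finset.range_orderEmbOfFin]
    obtain ⟨k, rfl⟩ := this
    refine ⟨k, k.2.le, ?_⟩
    simp only [e]
    congr 1
    ext
    simp only
    have := k.2
    omega
  refine ⟨e, hmono, ?_, s.card, hsurj⟩
  obtain ⟨i, -, hi⟩ := hsurj 0 h0
  exact le_antisymm (hi ▸ hmono (Nat.zero_le i)) zero_le

section Poisson

variable {Ω : Type*} [MeasurableSpace Ω] {P : Measure Ω}
  {rate : ℝ → ℝ} {N : ℝ≥0 → Ω → ℕ}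

/-- The counting process restarted at time `t`. -/
def restart (N : ℝ≥0 → Ω → ℕ) (t : ℝ≥0) (ω : Ω) (u : ℝ≥0) : ℕ := N (t + u) ω - N t ω

/-- The counting process stopped at time `t`. -/
def stopped (N : ℝ≥0 → Ω → ℕ) (t : ℝ≥0) (ω : Ω) (u : ℝ≥0) : ℕ := N (min u t) ω

theorem IsPoissonCounting.measurable_restart (hN : IsPoissonCounting P rate N) (t : ℝ≥0) :
    Measurable (restart N t) :=
  measurable_pi_lambda _ fun _ => (hN.measurable _).sub (hN.measurable _)

theorem IsPoissonCounting.measurable_stopped (hN : IsPoissonCounting P rate N) (t : ℝ≥0) :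
    Measurable (stopped N t) :=
  measurable_pi_lambda _ fun _ => hN.measurable _

/-- Independence of increments is stated for the real-valued process; the floor function recovers
the counts. -/
theorem floor_sum_increments (hN : IsPoissonCounting P rate N) {e : ℕ → ℝ≥0} (he : Monotone e)
    {a b : ℕ} (hab : a ≤ b) (ω : Ω) :
    ⌊∑ i ∈ Finset.Ico a b, ((N (e (i + 1)) ω : ℝ) - N (e i) ω)⌋₊ = N (e b) ω - N (e a) ω := by
  rw [Finset.sum_Ico_sub (fun i => (N (e i) ω : ℝ)) hab, ← Nat.cast_sub (hN.mono ω (he hab)),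
    Nat.floor_natCast]

/-- Finitely many values of the stopped and of the restarted process are functions of the
increments over two disjoint blocks of a common sequence of times. The stopped process is only
treated relative to `N 0`, which vanishes almost surely. -/
theorem IsPoissonCounting.indepFun_stopped_restart [IsProbabilityMeasure P]
    (hN : IsPoissonCounting P rate N) (t : ℝ≥0) :
    IndepFun (stopped N t) (restart N t) P := by
  have key : IndepFun (fun ω u => N (min u t) ω - N 0 ω) (restart N t) P := by
    refine IndepFun.process_indepFun_process
      (fun _ => (hN.measurable _).sub (hN.measurable _))
      (fun _ => (hN.measurable _).sub (hN.measurable _)) fun I J => ?_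
    obtain ⟨e, he, he0, n, hn⟩ := exists_monotone_enumeration
      ({0, t} ∪ I.image (fun u => min u t) ∪ J.image (fun u => t + u)) (by simp)
    obtain ⟨k, hkn, hk⟩ := hn t (by simp)
    have hI : ∀ u : I, ∃ i ≤ k, e i = min u.1 t := by
      intro u
      obtain ⟨i, -, hi⟩ := hn (min u.1 t) (by
        simp only [Finset.mem_union, Finset.mem_image]
        exact Or.inl (Or.inr ⟨u, u.2, rfl⟩))
      rcases le_total i k with h | h
      · exact ⟨i, h, hi⟩
      · refine ⟨k, le_rfl, le_antisymm ((he h).trans_eq hi) ?_⟩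
        rw [hk]; exact min_le_right _ _
    have hJ : ∀ u : J, ∃ i, k ≤ i ∧ i ≤ n ∧ e i = t + u.1 := by
      intro u
      obtain ⟨i, hin, hi⟩ := hn (t + u.1) (by
        simp only [Finset.mem_union, Finset.mem_image]
        exact Or.inr ⟨u, u.2, rfl⟩)
      rcases le_total k i with h | h
      · exact ⟨i, h, hin, hi⟩
      · refine ⟨k, le_rfl, hkn, le_antisymm ?_ (hi ▸ he h)⟩
        rw [hk]; exact le_self_add
    choose f hfk hf using hI
    choose g hgk hgn hg using hJ
    have hind := (hN.indep_increments.nat he).indepFun_finset (Finset.range k) (Finset.Ico k n)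
      (Finset.disjoint_left.2 fun i hi hj => by
        rw [Finset.mem_range] at hi; rw [Finset.mem_Ico] at hj; omega)
      fun i => (measurable_from_top.comp (hN.measurable _)).sub
        (measurable_from_top.comp (hN.measurable _))
    have hmeas : ∀ (S : Finset ℕ) (ι : Type) (s : ι → Finset ℕ), Measurable
        fun (v : S → ℝ) (u : ι) => ⌊∑ i ∈ S.attach, if i.1 ∈ s u then v i else 0⌋₊ := by
      intro S ι s
      refine measurable_pi_lambda _ fun u => Nat.measurable_floor.comp
        (Finset.measurable_sum _ fun i _ => ?_)
      split_ifs
      · exact measurable_pi_apply i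
      · exact measurable_const
    have := hind.comp (hmeas _ I fun u => Finset.Ico 0 (f u))
      (hmeas _ J fun u => Finset.Ico k (g u))
    convert this using 1
    · ext ω u
      rw [Function.comp_apply, Finset.sum_attach (Finset.range k) fun i =>
        if i ∈ Finset.Ico 0 (f u) then ((N (e (i + 1)) ω : ℝ) - N (e i) ω) else 0,
        Finset.sum_ite_mem, Finset.inter_eq_right.2, floor_sum_increments hN he (Nat.zero_le _),
        hf, he0]
      intro i hi
      have := hfk u
      rw [Finset.mem_Ico] at hi
      rw [Finset.mem_range]; omega
    · ext ω u
      rw [Function.comp_apply, Finset.sum_attach (Finset.Ico k n) fun i =>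
        if i ∈ Finset.Ico k (g u) then ((N (e (i + 1)) ω : ℝ) - N (e i) ω) else 0,
        Finset.sum_ite_mem, Finset.inter_eq_right.2, floor_sum_increments hN he (hgk u),
        hg, hk]
      · rfl
      · exact Finset.Ico_subset_Ico_right (hgn u)
  refine IndepFun.congr key ?_ (ae_eq_refl _)
  filter_upwards [hN.zero] with ω hω
  ext u
  rw [hω, Nat.sub_zero, stopped]

theorem IsPoissonCounting.identDistrib_increment (hN : IsPoissonCounting P rate N)
    {a b a' b' : ℝ≥0} (hab : a ≤ b) (hab' : a' ≤ b')
    (hrate : ∫ u in (a : ℝ)..b, rate u = ∫ u in (a' : ℝ)..b', rate u) :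
    IdentDistrib (fun ω => (N b ω : ℝ) - N a ω) (fun ω => (N b' ω : ℝ) - N a' ω) P P := by
  have h1 := hN.law_increment a b hab
  have h2 := hN.law_increment a' b' hab'
  rw [hrate] at h1
  have h3 := (h1.identDistrib h2).comp (measurable_from_top (f := fun k : ℕ => (k : ℝ)))
  have h4 : ∀ a b : ℝ≥0, a ≤ b → (fun ω => (N b ω : ℝ) - N a ω)
      = (fun k : ℕ => (k : ℝ)) ∘ fun ω => N b ω - N a ω := by
    intro a b hab
    ext ω
    rw [Function.comp_apply, Nat.cast_sub (hN.mono ω hab)]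
  rw [h4 a b hab, h4 a' b' hab']
  exact h3

theorem IsPoissonCounting.identDistrib_increments (hN : IsPoissonCounting P rate N)
    {a b : ℕ → ℝ≥0} (ha : Monotone a) (hb : Monotone b)
    (hrate : ∀ i, ∫ u in (a i : ℝ)..a (i + 1), rate u = ∫ u in (b i : ℝ)..b (i + 1), rate u) :
    IdentDistrib (fun ω (i : ℕ) => (N (a (i + 1)) ω : ℝ) - N (a i) ω)
      (fun ω (i : ℕ) => (N (b (i + 1)) ω : ℝ) - N (b i) ω) P P :=
  IdentDistrib.pi (fun i => hN.identDistrib_increment (ha (Nat.le_add_right i 1))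
    (hb (Nat.le_add_right i 1)) (hrate i)) (hN.indep_increments.nat ha)
    (hN.indep_increments.nat hb)

theorem IsPoissonCounting.identDistrib_restart [IsProbabilityMeasure P]
    (hN : IsPoissonCounting P rate N) {t t' : ℝ≥0}
    (hrate : ∀ a b : ℝ≥0, a ≤ b → ∫ u in ((t + a : ℝ≥0) : ℝ)..(t + b : ℝ≥0), rate u
      = ∫ u in ((t' + a : ℝ≥0) : ℝ)..(t' + b : ℝ≥0), rate u) :
    IdentDistrib (restart N t) (restart N t') P P := by
  refine (identDistrib_iff_forall_finset_identDistrib (X := fun u ω => restart N t ω u)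
    (Y := fun u ω => restart N t' ω u) (hN.measurable_restart t).aemeasurable
    (hN.measurable_restart t').aemeasurable).2 fun J => ?_
  obtain ⟨e, he, he0, n, hn⟩ := exists_monotone_enumeration ({0} ∪ J) (by simp)
  have hJ : ∀ u : J, ∃ i, e i = u.1 := fun u => by
    obtain ⟨i, -, hi⟩ := hn u (by simp)
    exact ⟨i, hi⟩
  choose g hg using hJ
  have hmono : ∀ t : ℝ≥0, Monotone fun i => t + e i := fun t i j hij =>
    add_le_add_right (he hij) t
  have hpi := hN.identDistrib_increments (hmono t) (hmono t')
    fun i => hrate _ _ (he (Nat.le_add_right i 1))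
  have hmeas : Measurable fun (v : ℕ → ℝ) (u : J) => ⌊∑ i ∈ Finset.Ico 0 (g u), v i⌋₊ :=
    measurable_pi_lambda _ fun u => Nat.measurable_floor.comp
      (Finset.measurable_sum _ fun i _ => measurable_pi_apply i)
  have h5 : ∀ t : ℝ≥0, ((fun (v : ℕ → ℝ) (u : J) => ⌊∑ i ∈ Finset.Ico 0 (g u), v i⌋₊)
        ∘ fun ω i => (N (t + e (i + 1)) ω : ℝ) - N (t + e i) ω)
      = fun ω => J.restrict fun u => restart N t ω u := by
    intro t
    ext ω u
    have := floor_sum_increments hN (hmono t) (Nat.zero_le (g u)) ω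
    rw [hg, he0, add_zero] at this
    exact this
  have h6 := hpi.comp hmeas
  rw [h5 t, h5 t'] at h6
  exact h6

end Poisson

/-! ### Marked Poisson processes restarted at a fixed time -/

section Marks

variable {l : ℕ}

/-- The marks with index at least `m`, renumbered from `0`. -/
def shiftMarks (m : ℕ) (z : ℕ × Fin l → ℝ) : ℕ × Fin l → ℝ := fun i => z (m + i.1, i.2)

/-- The marks with index less than `m`; the others are replaced by `0`. -/
def truncMarks (m : ℕ) (z : ℕ × Fin l → ℝ) : ℕ × Fin l → ℝ := fun i => if i.1 < m then z i else 0

theorem measurable_shiftMarks (m : ℕ) : Measurable (shiftMarks (l := l) m) :=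
  measurable_pi_lambda _ fun _ => measurable_pi_apply _

theorem measurable_truncMarks (m : ℕ) : Measurable (truncMarks (l := l) m) := by
  refine measurable_pi_lambda _ fun i => ?_
  simp only [truncMarks]
  split_ifs
  · exact measurable_pi_apply i
  · exact measurable_const

variable {Ω : Type*} [MeasurableSpace Ω] {P : Measure Ω}
  {ζ : Ω → ℕ × Fin l → ℝ}

theorem indepFun_truncMarks_shiftMarks [IsProbabilityMeasure P]
    (hm : Measurable ζ) (hind : iIndepFun (fun i ω => ζ ω i) P)
    (m : ℕ) : IndepFun (fun ω => truncMarks m (ζ ω)) (fun ω => shiftMarks m (ζ ω)) P := by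
  have hm' : ∀ i, Measurable fun ω => ζ ω i := fun i => (measurable_pi_apply i).comp hm
  refine IndepFun.indepFun_process ((measurable_truncMarks m).comp hm) (fun i => hm' _) fun J => ?_
  let S : Finset (ℕ × Fin l) := Finset.range m ×ˢ Finset.univ
  let T : Finset (ℕ × Fin l) := J.image fun i => (m + i.1, i.2)
  have hST : Disjoint S T := Finset.disjoint_left.2 fun i hi hj => by
    simp only [S, T, Finset.mem_product, Finset.mem_range, Finset.mem_image] at hi hj
    obtain ⟨k, -, rfl⟩ := hj
    have := hi.1
    simp only at this
    omega
  have h := hind.indepFun_finset S T hST hm'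
  have h1 : Measurable fun (v : S → ℝ) (i : ℕ × Fin l) => if hi : i ∈ S then v ⟨i, hi⟩ else 0 := by
    refine measurable_pi_lambda _ fun i => ?_
    split_ifs
    · exact measurable_pi_apply _
    · exact measurable_const
  have h2 : Measurable fun (v : T → ℝ) (i : J) =>
      v ⟨(m + i.1.1, i.1.2), Finset.mem_image_of_mem _ i.2⟩ :=
    measurable_pi_lambda _ fun i => measurable_pi_apply _
  convert h.comp h1 h2 using 1
  · ext ω i
    simp [truncMarks, S]
  · rfl

theorem map_shiftMarks (hm : Measurable ζ) (hind : iIndepFun (fun i ω => ζ ω i) P)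
    {F : Fin l → Measure ℝ} (hlaw : ∀ i, HasLaw (fun ω => ζ ω i) (F i.2) P) (m : ℕ) :
    P.map (fun ω => shiftMarks m (ζ ω)) = P.map ζ := by
  have hm' : ∀ i, Measurable fun ω => ζ ω i := fun i => (measurable_pi_apply i).comp hm
  have hinj : Function.Injective fun i : ℕ × Fin l => (m + i.1, i.2) := fun i j hij => by
    simp only [Prod.mk.injEq, Nat.add_left_cancel_iff] at hij
    exact Prod.ext hij.1 hij.2
  have h1 := hind.hasLaw_infinitePi hlaw (measurable_pi_lambda _ hm').aemeasurable
  have h2 := (hind.precomp hinj).hasLaw_infinitePi (μ := fun i => F i.2)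
    (fun i => hlaw (m + i.1, i.2)) (measurable_pi_lambda _ fun i => hm' _).aemeasurable
  exact h2.map_eq.trans h1.map_eq.symm

end Marks

section Restart

variable {l : ℕ} {Ω : Type*} [MeasurableSpace Ω] {P : Measure Ω}
  {rate : ℝ → ℝ} {N : ℝ≥0 → Ω → ℕ} {ζ : Ω → ℕ × Fin l → ℝ}

/-- The points and marks up to time `t`. -/
def markedPast (N : ℝ≥0 → Ω → ℕ) (ζ : Ω → ℕ × Fin l → ℝ) (t : ℝ≥0) (ω : Ω) :
    (ℝ≥0 → ℕ) × (ℕ × Fin l → ℝ) :=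
  (stopped N t ω, truncMarks (N t ω) (ζ ω))

/-- The points and marks after time `t`, with time and marks renumbered. -/
def markedFuture (N : ℝ≥0 → Ω → ℕ) (ζ : Ω → ℕ × Fin l → ℝ) (t : ℝ≥0) (ω : Ω) :
    (ℝ≥0 → ℕ) × (ℕ × Fin l → ℝ) :=
  (restart N t ω, shiftMarks (N t ω) (ζ ω))

theorem measurable_comp_nat {α β : Type*} [MeasurableSpace α] [MeasurableSpace β] {M : Ω → ℕ}
    (hM : Measurable M) {f : ℕ → α → β} (hf : ∀ m, Measurable (f m)) {ξ : Ω → α}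
    (hξ : Measurable ξ) : Measurable fun ω => f (M ω) (ξ ω) :=
  (measurable_from_prod_countable_right (f := fun z : ℕ × α => f z.1 z.2) hf).comp (hM.prodMk hξ)

theorem IsPoissonCounting.measurable_markedPast (hN : IsPoissonCounting P rate N)
    (hm : Measurable ζ) (t : ℝ≥0) : Measurable (markedPast N ζ t) :=
  (hN.measurable_stopped t).prodMk
    (measurable_comp_nat (hN.measurable t) measurable_truncMarks hm)

theorem IsPoissonCounting.measurable_markedFuture (hN : IsPoissonCounting P rate N)
    (hm : Measurable ζ) (t : ℝ≥0) : Measurable (markedFuture N ζ t) :=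
  (hN.measurable_restart t).prodMk
    (measurable_comp_nat (hN.measurable t) measurable_shiftMarks hm)

/-- The Markov property at a fixed time: the renumbered future is independent
of the past and consists of independent points and marks. It follows by summation over the number
of points up to time `t`. -/
theorem IsPoissonCounting.measure_markedPast_inter [IsProbabilityMeasure P]
    (hN : IsPoissonCounting P rate N)
    (hm : Measurable ζ) (hind : iIndepFun (fun i ω => ζ ω i) P)
    {F : Fin l → Measure ℝ} (hlaw : ∀ i, HasLaw (fun ω => ζ ω i) (F i.2) P)
    (hNζ : IndepFun (fun ω t => N t ω) ζ P) (t : ℝ≥0)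
    {A C : Set ((ℝ≥0 → ℕ) × (ℕ × Fin l → ℝ))} (hA : MeasurableSet A) (hC : MeasurableSet C) :
    P (markedPast N ζ t ⁻¹' A ∩ markedFuture N ζ t ⁻¹' C)
      = P (markedPast N ζ t ⁻¹' A) * ((P.map (restart N t)).prod (P.map ζ)) C := by
  have hX := hN.measurable_stopped t
  have hX' := hN.measurable_restart t
  have hT : ∀ m, Measurable fun ω => truncMarks m (ζ ω) := fun m =>
    (measurable_truncMarks m).comp hm
  have hS : ∀ m, Measurable fun ω => shiftMarks m (ζ ω) := fun m =>
    (measurable_shiftMarks m).comp hm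
  have hcount : ∀ E : Set Ω, MeasurableSet E → P E = ∑' m : ℕ, P (E ∩ N t ⁻¹' {m}) := by
    intro E hE
    rw [← measure_iUnion (fun i j hij => ?_)
      fun m => hE.inter (hN.measurable t (measurableSet_singleton m))]
    · congr 1
      ext ω; simp
    · refine Disjoint.inter_left' _ (Disjoint.inter_right' _ ?_)
      exact Disjoint.preimage _ (disjoint_singleton.2 hij)
  have hNpair : Measurable fun n : ℝ≥0 → ℕ =>
      ((fun u => n (min u t), fun u => n (t + u) - n t) : (ℝ≥0 → ℕ) × (ℝ≥0 → ℕ)) := by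
    refine Measurable.prodMk ?_ ?_ <;> refine measurable_pi_lambda _ fun u => ?_
    · exact measurable_pi_apply _
    · exact (measurable_pi_apply _).sub (measurable_pi_apply _)
  have hmain : ∀ m, P (markedPast N ζ t ⁻¹' A ∩ markedFuture N ζ t ⁻¹' C ∩ N t ⁻¹' {m})
      = P (markedPast N ζ t ⁻¹' A ∩ N t ⁻¹' {m})
        * ((P.map (restart N t)).prod (P.map ζ)) C := by
    intro m
    have h1 := hNζ.comp hNpair
      ((measurable_truncMarks (l := l) m).prodMk (measurable_shiftMarks (l := l) m))
    have h2 : IndepFun (fun ω => (stopped N t ω, truncMarks m (ζ ω)))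
        (fun ω => (restart N t ω, shiftMarks m (ζ ω))) P :=
      indepFun_prodMk_prodMk_of_indepFun hX hX' (hT m) (hS m) (hN.indepFun_stopped_restart t)
        (indepFun_truncMarks_shiftMarks hm hind m) h1
    have h3 : IndepFun (restart N t) (fun ω => shiftMarks m (ζ ω)) P :=
      h1.comp measurable_snd measurable_snd
    have h4 : P.map (fun ω => (restart N t ω, shiftMarks m (ζ ω)))
        = (P.map (restart N t)).prod (P.map ζ) := by
      rw [h3.map_prod_eq_prod_map_map hX'.aemeasurable (hS m).aemeasurable,
        map_shiftMarks hm hind hlaw m]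
    have hA' : MeasurableSet (A ∩ {z | z.1 t = m}) :=
      hA.inter (measurableSet_eq_fun ((measurable_pi_apply t).comp measurable_fst)
        measurable_const)
    have h5 := h2.measure_inter_preimage_eq_mul _ C hA' hC
    have e1 : (fun ω => (stopped N t ω, truncMarks m (ζ ω))) ⁻¹' (A ∩ {z | z.1 t = m})
        = markedPast N ζ t ⁻¹' A ∩ N t ⁻¹' {m} := by
      ext ω
      simp only [mem_preimage, mem_inter_iff, mem_ofPred_eq, stopped, min_self, markedPast,
        mem_singleton_iff]
      constructor
      · rintro ⟨h, h'⟩; rw [h']; exact ⟨h, rfl⟩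
      · rintro ⟨h, h'⟩; rw [h'] at h; exact ⟨h, h'⟩
    have e2 : markedPast N ζ t ⁻¹' A ∩ markedFuture N ζ t ⁻¹' C ∩ N t ⁻¹' {m}
        = (markedPast N ζ t ⁻¹' A ∩ N t ⁻¹' {m})
          ∩ (fun ω => (restart N t ω, shiftMarks m (ζ ω))) ⁻¹' C := by
      ext ω
      simp only [mem_preimage, mem_inter_iff, markedFuture, mem_singleton_iff]
      constructor
      · rintro ⟨⟨h, h''⟩, h'⟩; rw [h'] at h''; exact ⟨⟨h, h'⟩, h''⟩
      · rintro ⟨⟨h, h'⟩, h''⟩; rw [h']; exact ⟨⟨h, h''⟩, rfl⟩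
    rw [e2, ← e1, h5, ← h4, Measure.map_apply (hX'.prodMk (hS m)) hC]
  have hA1 := hN.measurable_markedPast hm t hA
  have hC1 := hN.measurable_markedFuture hm t hC
  rw [hcount _ (hA1.inter hC1), hcount _ hA1, ← ENNReal.tsum_mul_right]
  exact tsum_congr hmain

/-- The law of the future depends on `t` only through the law of the restarted counting process. -/
theorem IsPoissonCounting.map_markedFuture [IsProbabilityMeasure P]
    (hN : IsPoissonCounting P rate N)
    (hm : Measurable ζ) (hind : iIndepFun (fun i ω => ζ ω i) P)
    {F : Fin l → Measure ℝ} (hlaw : ∀ i, HasLaw (fun ω => ζ ω i) (F i.2) P)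
    (hNζ : IndepFun (fun ω t => N t ω) ζ P) (t : ℝ≥0) :
    P.map (markedFuture N ζ t) = (P.map (restart N t)).prod (P.map ζ) := by
  ext C hC
  have := hN.measure_markedPast_inter hm hind hlaw hNζ t MeasurableSet.univ hC
  rw [Measure.map_apply (hN.measurable_markedFuture hm t) hC]
  simpa using this

theorem IsPoissonCounting.indepFun_markedPast_markedFuture [IsProbabilityMeasure P]
    (hN : IsPoissonCounting P rate N)
    (hm : Measurable ζ) (hind : iIndepFun (fun i ω => ζ ω i) P)
    {F : Fin l → Measure ℝ} (hlaw : ∀ i, HasLaw (fun ω => ζ ω i) (F i.2) P)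
    (hNζ : IndepFun (fun ω t => N t ω) ζ P) (t : ℝ≥0) :
    IndepFun (markedPast N ζ t) (markedFuture N ζ t) P := by
  rw [indepFun_iff_measure_inter_preimage_eq_mul]
  intro A C hA hC
  rw [hN.measure_markedPast_inter hm hind hlaw hNζ t hA hC,
    ← hN.map_markedFuture hm hind hlaw hNζ t,
    Measure.map_apply (hN.measurable_markedFuture hm t) hC]

end Restart

/-! ### The driving process as a functional of points and marks -/

section Arrival

variable {n : ℝ≥0 → ℕ}

theorem isLeast_arrival (hmono : Monotone n)
    (hr : ∀ t, ContinuousWithinAt n (Ici t) t) {i : ℕ} (h : ∃ s, i ≤ n s) :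
    IsLeast {s | i ≤ n s} (sInf {s | i ≤ n s}) := by
  refine ⟨?_, fun s hs => csInf_le (OrderBot.bddBelow _) hs⟩
  set σ := sInf {s | i ≤ n s}
  have h1 : ∀ᶠ s in 𝓝[>] σ, n s = n σ := by
    have := (hr σ).mono Ioi_subset_Ici_self
    rw [ContinuousWithinAt, nhds_discrete, tendsto_pure] at this
    exact this
  obtain ⟨s, hs, hσs⟩ := (h1.and self_mem_nhdsWithin).exists
  obtain ⟨v, hv, hvs⟩ := (csInf_lt_iff (OrderBot.bddBelow _) h).1 hσs
  exact (le_trans hv (hmono hvs.le)).trans_eq hs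

/-- The `i`-th arrival time as an infimum over rational times, which makes it a measurable
functional of the counting path. -/
def arrival (n : ℝ≥0 → ℕ) (i : ℕ) : ℝ≥0 :=
  (⨅ r : ℚ, if i ≤ n (r : ℝ).toNNReal then ((r : ℝ).toNNReal : ENNReal) else ⊤).toNNReal

theorem measurable_arrival (i : ℕ) : Measurable fun n : ℝ≥0 → ℕ => arrival n i := by
  refine ENNReal.measurable_toNNReal.comp (Measurable.iInf fun r => ?_)
  exact Measurable.ite (measurable_pi_apply (r : ℝ).toNNReal measurableSet_Ici) measurable_const
    measurable_const

theorem arrival_eq_sInf (hmono : Monotone n)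
    (hr : ∀ t, ContinuousWithinAt n (Ici t) t) {i : ℕ} (h : ∃ s, i ≤ n s) :
    arrival n i = sInf {s | i ≤ n s} := by
  obtain ⟨h1, h2⟩ := isLeast_arrival hmono hr h
  set σ := sInf {s | i ≤ n s}
  rw [arrival]
  suffices hs :
      (⨅ r : ℚ, if i ≤ n (r : ℝ).toNNReal then ((r : ℝ).toNNReal : ENNReal) else ⊤) = σ by
    rw [hs, ENNReal.toNNReal_coe]
  refine le_antisymm (le_of_forall_gt fun c hc => ?_) (le_iInf fun r => ?_)
  · obtain ⟨b, hb1, hb2⟩ := ENNReal.lt_iff_exists_nnreal_btwn.1 hc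
    have hb1 : σ < b := by exact_mod_cast hb1
    obtain ⟨r, hr1, hr2⟩ := NNReal.lt_iff_exists_rat_btwn σ b |>.1 hb1
    obtain ⟨hr2, hr3⟩ := hr2
    refine lt_of_le_of_lt (iInf_le _ r) (lt_of_le_of_lt ?_ hb2)
    rw [if_pos (le_trans h1 (hmono hr2.le))]
    exact_mod_cast hr3.le
  · split_ifs with hi
    · exact_mod_cast h2 hi
    · exact le_top

end Arrival

/-! ### Periodicity of the driving data -/

namespace SemiLevyData

variable (θ : SemiLevyData)

theorem part_add_l (j : ℕ) : θ.part (j + θ.l) = θ.part j + θ.period := by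
  induction j with
  | zero => simp [θ.part_zero, period]
  | succ j ih =>
    have h := θ.part_periodic j
    rw [← NNReal.coe_inj, NNReal.coe_add] at ih ⊢
    linarith

theorem add_period_mem_cell_iff (j : Fin θ.l) (s : ℝ≥0) :
    s + θ.period ∈ θ.cell j ↔ s ∈ θ.cell j := by
  have h : ∀ i k : ℕ, θ.part (i + (k + 1) * θ.l) = θ.part (i + k * θ.l) + θ.period := by
    intro i k
    rw [← θ.part_add_l]; congr 1; ring
  simp only [cell, mem_iUnion, mem_Ico]
  constructor
  · rintro ⟨k, hk1, hk2⟩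
    rcases k with _ | k
    · -- The cells of the first period end at the period, hence contain no point `s + τ`.
      have h1 : θ.part (j + 1 + 0 * θ.l) ≤ θ.period :=
        θ.part_strictMono.monotone (by have := j.2; omega)
      exact absurd (hk2.trans_le h1) (not_lt.2 le_add_self)
    · rw [h] at hk1 hk2
      exact ⟨k, le_of_add_le_add_right hk1, lt_of_add_lt_add_right hk2⟩
  · rintro ⟨k, hk1, hk2⟩
    refine ⟨k + 1, ?_, ?_⟩
    · rw [h]; gcongr
    · rw [h]; gcongr

theorem add_mul_period_mem_cell_iff (j : Fin θ.l) (s : ℝ≥0) (k : ℕ) :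
    s + k * θ.period ∈ θ.cell j ↔ s ∈ θ.cell j := by
  induction k with
  | zero => simp
  | succ k ih =>
    rw [← ih, ← θ.add_period_mem_cell_iff j (s + k * θ.period)]
    push_cast
    rw [add_mul, one_mul, add_assoc]

theorem measurableSet_cell (j : Fin θ.l) : MeasurableSet (θ.cell j) :=
  MeasurableSet.iUnion fun _ => measurableSet_Ico

theorem drift_add_mul_period (t : ℝ≥0) (k : ℕ) : θ.drift (t + k * θ.period) = θ.drift t := by
  induction k with
  | zero => simp
  | succ k ih =>
    rw [← ih, ← θ.drift_periodic (t + k * θ.period)]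
    push_cast
    rw [add_mul, one_mul, add_assoc]
    rfl

theorem rate_add_mul_period {u : ℝ} (hu : 0 ≤ u) (k : ℕ) :
    θ.rate (u + k * θ.period) = θ.rate u := by
  induction k with
  | zero => simp
  | succ k ih =>
    rw [← ih, ← θ.rate_periodic (u + k * θ.period) (by positivity)]
    push_cast
    rw [add_mul, one_mul, add_assoc]
    rfl

theorem integral_rate_add_mul_period (t : ℝ≥0) (k : ℕ) (a b : ℝ≥0) (hab : a ≤ b) :
    ∫ u in ((t + a : ℝ≥0) : ℝ)..(t + b : ℝ≥0), θ.rate u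
      = ∫ u in ((t + k * θ.period + a : ℝ≥0) : ℝ)..(t + k * θ.period + b : ℝ≥0), θ.rate u := by
  have h1 : ∀ c : ℝ≥0, ((t + k * θ.period + c : ℝ≥0) : ℝ)
      = ((t + c : ℝ≥0) : ℝ) + ((k * θ.period : ℝ≥0) : ℝ) := fun c => by push_cast; ring
  rw [h1, h1, ← intervalIntegral.integral_comp_add_right]
  refine intervalIntegral.integral_congr fun u hu => ?_
  rw [uIcc_of_le (NNReal.coe_le_coe.2 (by gcongr))] at hu
  push_cast
  exact (θ.rate_add_mul_period ((NNReal.coe_nonneg _).trans hu.1) k).symm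

open Classical in
/-- The increments of the driving process after time `t`, as a functional of the points and marks
after time `t`. -/
def jumpSum (t : ℝ≥0) (z : (ℝ≥0 → ℕ) × (ℕ × Fin θ.l → ℝ)) (u : ℝ≥0) : ℝ :=
  θ.drift (t + u) - θ.drift t + ∑ i ∈ Finset.range (z.1 u), ∑ j : Fin θ.l,
    if t + arrival z.1 (i + 1) ∈ θ.cell j then z.2 (i, j) else 0

open Classical in
theorem measurable_jumpSum (t : ℝ≥0) : Measurable (θ.jumpSum t) := by
  refine measurable_pi_lambda _ fun u => ?_
  have h : ∀ m : ℕ, Measurable fun z : (ℝ≥0 → ℕ) × (ℕ × Fin θ.l → ℝ) =>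
      ∑ i ∈ Finset.range m, ∑ j : Fin θ.l,
        if t + arrival z.1 (i + 1) ∈ θ.cell j then z.2 (i, j) else 0 := fun m =>
    Finset.measurable_sum _ fun i _ => Finset.measurable_sum _ fun j _ =>
      Measurable.ite ((((measurable_arrival (i + 1)).comp measurable_fst).const_add t)
        (θ.measurableSet_cell j)) ((measurable_pi_apply _).comp measurable_snd) measurable_const
  have hM : Measurable fun z : (ℝ≥0 → ℕ) × (ℕ × Fin θ.l → ℝ) => z.1 u :=
    (measurable_pi_apply u).comp measurable_fst
  exact (measurable_comp_nat hM h measurable_id).const_add _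

open Classical in
theorem jumpSum_add_mul_period (t : ℝ≥0) (k : ℕ) :
    θ.jumpSum (t + k * θ.period) = θ.jumpSum t := by
  ext z u
  simp only [jumpSum]
  rw [add_right_comm, θ.drift_add_mul_period, θ.drift_add_mul_period]
  congr 1
  refine Finset.sum_congr rfl fun i _ => Finset.sum_congr rfl fun j _ => ?_
  rw [add_right_comm, if_congr (θ.add_mul_period_mem_cell_iff j _ k) rfl rfl]

end SemiLevyData

/-! ### Paths of the driving process -/

section Driving

variable {Ω : Type*} [MeasurableSpace Ω] {P : Measure Ω} {θ : SemiLevyData} {N : ℝ≥0 → Ω → ℕ}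
  {Z : ℕ+ → Fin θ.l → Ω → ℝ}

/-- The marks, numbered from `0` instead of `1`. -/
def marks (Z : ℕ+ → Fin θ.l → Ω → ℝ) (ω : Ω) (i : ℕ × Fin θ.l) : ℝ := Z i.1.succPNat i.2 ω

theorem IsPoissonCounting.eventually_eq {rate : ℝ → ℝ} (hN : IsPoissonCounting P rate N) (ω : Ω)
    (t : ℝ≥0) : ∀ᶠ s in 𝓝[≥] t, N s ω = N t ω := by
  have := hN.right_continuous ω t
  rw [ContinuousWithinAt, nhds_discrete, tendsto_pure] at this
  exact this

theorem IsPoissonCounting.exists_eq_on_Ico {rate : ℝ → ℝ} (hN : IsPoissonCounting P rate N)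
    (ω : Ω) (t : ℝ≥0) : ∃ ε > 0, ∀ s ∈ Ico t (t + ε), N s ω = N t ω := by
  obtain ⟨b, hb, h⟩ := (mem_nhdsGE_iff_exists_Ico_subset' (lt_add_one t)).1 (hN.eventually_eq ω t)
  refine ⟨b - t, tsub_pos_of_lt hb, fun s hs => h ⟨hs.1, ?_⟩⟩
  rw [add_tsub_cancel_of_le (le_of_lt hb)] at hs
  exact hs.2

theorem SemiLevyData.exists_continuousOn_process {rate : ℝ → ℝ} (θ : SemiLevyData)
    (hN : IsPoissonCounting P rate N) (Z : ℕ+ → Fin θ.l → Ω → ℝ) (ω : Ω) (t : ℝ≥0) :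
    ∃ ε > 0, ContinuousOn (fun s => θ.process N Z s ω) (Ico t (t + ε)) := by
  obtain ⟨ε, hε, h⟩ := hN.exists_eq_on_Ico ω t
  refine ⟨ε, hε, ContinuousOn.congr (f := fun s => θ.drift s
    + ∑ n ∈ Finset.range (N t ω), θ.jump N Z n.succPNat ω) ?_ fun s hs => ?_⟩
  · exact (θ.drift_continuous.add continuous_const).continuousOn
  · simp only [SemiLevyData.process]
    rw [h s hs]

theorem SemiLevyData.isFV_process {rate : ℝ → ℝ} (θ : SemiLevyData)
    (hN : IsPoissonCounting P rate N) (Z : ℕ+ → Fin θ.l → Ω → ℝ) (ω : Ω) :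
    IsFV fun s => θ.process N Z s ω := by
  refine IsFV.of_right_continuous (fun t => ?_) fun a b _ _ => ?_
  · have h1 : Tendsto (fun s => θ.drift s + ∑ n ∈ Finset.range (N t ω), θ.jump N Z n.succPNat ω)
        (𝓝[≥] t) (𝓝 (θ.process N Z t ω)) :=
      ((θ.drift_continuous.tendsto t).mono_left nhdsWithin_le_nhds).add_const _
    refine h1.congr' ?_
    filter_upwards [hN.eventually_eq ω t] with s hs
    rw [SemiLevyData.process, hs]
  · obtain ⟨p, q, hp, hq, hpq⟩ := θ.drift_finite_variation.exists_monotoneOn_sub_monotoneOn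
    refine BoundedVariationOn.mono (boundedVariationOn_inter_Icc_of_abs_sub_le
      (F := fun u => p u + q u + ∑ n ∈ Finset.range (N u ω), |θ.jump N Z n.succPNat ω|) b
      fun c d hcd _ => ?_) (inter_subset_inter_right _ (Icc_subset_Icc_left zero_le))
    have h1 := hp (mem_univ c) (mem_univ d) hcd
    have h2 := hq (mem_univ c) (mem_univ d) hcd
    have h3 : |θ.drift d - θ.drift c| ≤ (p d + q d) - (p c + q c) := by
      rw [hpq]
      simp only [Pi.sub_apply]
      rw [abs_le]; constructor <;> linarith
    have h4 := Finset.sum_range_add_sum_Ico (fun n => θ.jump N Z n.succPNat ω) (hN.mono ω hcd)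
    have h5 := Finset.sum_range_add_sum_Ico (fun n => |θ.jump N Z n.succPNat ω|) (hN.mono ω hcd)
    have h6 := Finset.abs_sum_le_sum_abs (fun n => θ.jump N Z n.succPNat ω)
      (Finset.Ico (N c ω) (N d ω))
    simp only [SemiLevyData.process]
    rw [← h4, ← h5]
    have h7 := abs_add_le (θ.drift d - θ.drift c)
      (∑ n ∈ Finset.Ico (N c ω) (N d ω), θ.jump N Z n.succPNat ω)
    have h8 : θ.drift d + (∑ n ∈ Finset.range (N c ω), θ.jump N Z n.succPNat ω
          + ∑ n ∈ Finset.Ico (N c ω) (N d ω), θ.jump N Z n.succPNat ω)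
        - (θ.drift c + ∑ n ∈ Finset.range (N c ω), θ.jump N Z n.succPNat ω)
        = (θ.drift d - θ.drift c)
          + ∑ n ∈ Finset.Ico (N c ω) (N d ω), θ.jump N Z n.succPNat ω := by ring
    rw [h8]
    linarith

/-! ### Past and future of the driving process -/

/-- The arrival times after `t` are `t` plus the arrival times of the restarted process. -/
theorem arrivalTime_eq_add_arrival {rate : ℝ → ℝ} (hN : IsPoissonCounting P rate N) (t : ℝ≥0)
    (ω : Ω) {i : ℕ} (h : ∃ u, i + 1 ≤ restart N t ω u) :
    arrivalTime N (N t ω + i + 1) ω = t + arrival (restart N t ω) (i + 1) := by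
  have hmono : Monotone (restart N t ω) := fun u v huv =>
    Nat.sub_le_sub_right (hN.mono ω (add_le_add_right huv t)) _
  have hr : ∀ u, ContinuousWithinAt (restart N t ω) (Ici u) u := by
    intro u
    have h1 : ContinuousWithinAt (fun v : ℝ≥0 => N (t + v) ω) (Ici u) u :=
      ContinuousWithinAt.comp (f := fun v : ℝ≥0 => t + v) (g := fun s => N s ω)
        (hN.right_continuous ω (t + u)) (by fun_prop) fun v hv => add_le_add_right hv t
    exact (continuous_of_discreteTopology (f := fun m : ℕ => m - N t ω)).continuousAt
      |>.comp_continuousWithinAt h1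
  rw [arrival_eq_sInf hmono hr h]
  have hleast := isLeast_arrival hmono hr h
  refine IsLeast.csInf_eq ⟨?_, ?_⟩
  · have := hleast.1
    simp only [restart, mem_ofPred_eq] at this ⊢
    omega
  · intro s hs
    have hs : N t ω + i + 1 ≤ N s ω := hs
    have hts : t ≤ s := by
      by_contra hlt
      have := hN.mono ω (le_of_not_ge hlt)
      simp only at this
      omega
    obtain ⟨u, rfl⟩ := exists_add_of_le hts
    refine add_le_add_right (hleast.2 ?_) t
    simp only [restart, mem_ofPred_eq]
    omega

open Classical in
theorem SemiLevyData.process_sub_eq_jumpSum {rate : ℝ → ℝ} (θ : SemiLevyData)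
    (hN : IsPoissonCounting P rate N) (Z : ℕ+ → Fin θ.l → Ω → ℝ) (t u : ℝ≥0) (ω : Ω) :
    θ.process N Z (t + u) ω - θ.process N Z t ω
      = θ.jumpSum t (markedFuture N (marks Z) t ω) u := by
  have hNu : N (t + u) ω = N t ω + restart N t ω u :=
    (Nat.add_sub_cancel' (hN.mono ω le_self_add)).symm
  rw [SemiLevyData.process, SemiLevyData.process, hNu, Finset.sum_range_add, SemiLevyData.jumpSum]
  have h : ∑ i ∈ Finset.range (restart N t ω u), θ.jump N Z (N t ω + i).succPNat ω
      = ∑ i ∈ Finset.range ((markedFuture N (marks Z) t ω).1 u), ∑ j : Fin θ.l,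
        if t + arrival (markedFuture N (marks Z) t ω).1 (i + 1) ∈ θ.cell j
        then (markedFuture N (marks Z) t ω).2 (i, j) else 0 := by
    refine Finset.sum_congr rfl fun i hi => ?_
    have hi : i < restart N t ω u := Finset.mem_range.1 hi
    refine Finset.sum_congr rfl fun j _ => ?_
    rw [Nat.succPNat_coe, Nat.succ_eq_add_one, arrivalTime_eq_add_arrival hN t ω ⟨u, hi⟩]
    rfl
  rw [h]
  ring

open Classical in
theorem SemiLevyData.process_sub_eq_jumpSum_past {rate : ℝ → ℝ} (θ : SemiLevyData)
    (hN : IsPoissonCounting P rate N) (Z : ℕ+ → Fin θ.l → Ω → ℝ) {t u : ℝ≥0} (hu : u ≤ t) {ω : Ω}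
    (h0 : N 0 ω = 0) :
    θ.process N Z u ω - θ.process N Z 0 ω = θ.jumpSum 0 (markedPast N (marks Z) t ω) u := by
  have hmono : Monotone (stopped N t ω) := fun u v huv =>
    hN.mono ω (min_le_min_right t huv)
  have hr : ∀ u, ContinuousWithinAt (stopped N t ω) (Ici u) u := by
    intro u
    exact ContinuousWithinAt.comp (f := fun v : ℝ≥0 => min v t) (g := fun s => N s ω)
        (hN.right_continuous ω (min u t)) (by fun_prop) fun v hv => min_le_min_right t hv
  have hmin : stopped N t ω u = N u ω := by rw [stopped, min_eq_left hu]
  rw [SemiLevyData.process, SemiLevyData.process, h0, SemiLevyData.jumpSum]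
  have h : ∑ i ∈ Finset.range (N u ω), θ.jump N Z i.succPNat ω
      = ∑ i ∈ Finset.range ((markedPast N (marks Z) t ω).1 u), ∑ j : Fin θ.l,
        if 0 + arrival (markedPast N (marks Z) t ω).1 (i + 1) ∈ θ.cell j
        then (markedPast N (marks Z) t ω).2 (i, j) else 0 := by
    refine Finset.sum_congr (by rw [← hmin]; rfl) fun i hi => ?_
    have hi : i < stopped N t ω u := Finset.mem_range.1 hi
    have hiu : i + 1 ≤ N u ω := hmin ▸ hi
    have hit : i < N t ω := lt_of_lt_of_le hiu (hN.mono ω hu)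
    have harr : arrivalTime N (i + 1) ω = 0 + arrival (stopped N t ω) (i + 1) := by
      rw [zero_add, arrival_eq_sInf hmono hr ⟨u, hi⟩]
      have hleast := isLeast_arrival hmono hr ⟨u, hi⟩
      refine IsLeast.csInf_eq ⟨?_, ?_⟩
      · exact le_trans hleast.1 (hN.mono ω (min_le_left _ _))
      · intro s hs
        rcases le_total s u with hsu | hsu
        · refine hleast.2 ?_
          change i + 1 ≤ N (min s t) ω
          rw [min_eq_left (hsu.trans hu)]
          exact hs
        · exact (hleast.2 hi).trans hsu
    refine Finset.sum_congr rfl fun j _ => ?_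
    rw [Nat.succPNat_coe, Nat.succ_eq_add_one, harr]
    simp only [markedPast, truncMarks, hit, if_true, marks]
  rw [h, Finset.range_zero, Finset.sum_empty, add_zero, add_sub_right_comm, zero_add u]

theorem SemiLevyData.IsSource.measurable_marks (hS : θ.IsSource P N Z) :
    Measurable (marks Z) :=
  measurable_pi_lambda _ fun _ => hS.measurable_mark _ _

theorem SemiLevyData.IsSource.iIndepFun_marks (hS : θ.IsSource P N Z) :
    iIndepFun (fun i ω => marks Z ω i) P :=
  hS.indep_marks.precomp (g := fun i : ℕ × Fin θ.l => (i.1.succPNat, i.2)) fun i j hij => by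
    simp only [Prod.mk.injEq] at hij
    exact Prod.ext (Nat.succPNat_injective hij.1) hij.2

theorem SemiLevyData.IsSource.indepFun_marks (hS : θ.IsSource P N Z) :
    IndepFun (fun ω t => N t ω) (marks Z) P :=
  hS.indep_poisson_marks.comp measurable_id
    (ψ := fun (z : ℕ+ × Fin θ.l → ℝ) (i : ℕ × Fin θ.l) => z (i.1.succPNat, i.2))
    (measurable_pi_lambda _ fun _ => measurable_pi_apply _)

theorem SemiLevyData.IsSource.measurable_futureIncrements (hS : θ.IsSource P N Z) (t : ℝ≥0) :
    Measurable fun ω u => θ.process N Z (t + u) ω - θ.process N Z t ω := by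
  have h : (fun ω u => θ.process N Z (t + u) ω - θ.process N Z t ω)
      = θ.jumpSum t ∘ markedFuture N (marks Z) t := by
    ext ω u
    exact θ.process_sub_eq_jumpSum hS.poisson Z t u ω
  rw [h]
  exact (θ.measurable_jumpSum t).comp
    (hS.poisson.measurable_markedFuture hS.measurable_marks t)

/-- The increments of the driving process after a fixed time are independent of its past. -/
theorem SemiLevyData.IsSource.indepFun_past_future [IsProbabilityMeasure P]
    (hS : θ.IsSource P N Z) (t : ℝ≥0) :
    IndepFun (fun ω u => θ.process N Z (min u t) ω - θ.process N Z 0 ω)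
      (fun ω u => θ.process N Z (t + u) ω - θ.process N Z t ω) P := by
  have h := hS.poisson.indepFun_markedPast_markedFuture hS.measurable_marks hS.iIndepFun_marks
    (fun i => hS.law_mark _ _) hS.indepFun_marks t
  have hm : Measurable fun z u => θ.jumpSum 0 z (min u t) :=
    measurable_pi_lambda _ fun u => (measurable_pi_apply _).comp (θ.measurable_jumpSum 0)
  refine (h.comp hm (θ.measurable_jumpSum t)).congr ?_ ?_
  · filter_upwards [hS.poisson.zero] with ω hω
    ext u
    exact (θ.process_sub_eq_jumpSum_past hS.poisson Z (min_le_right u t) hω).symm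
  · filter_upwards with ω
    ext u
    exact (θ.process_sub_eq_jumpSum hS.poisson Z t u ω).symm

/-- The law of the increments of the driving process after time `t` is periodic in `t`. -/
theorem SemiLevyData.IsSource.identDistrib_future [IsProbabilityMeasure P]
    (hS : θ.IsSource P N Z) (t : ℝ≥0) (k : ℕ) :
    IdentDistrib (fun ω u => θ.process N Z (t + u) ω - θ.process N Z t ω)
      (fun ω u => θ.process N Z (t + k * θ.period + u) ω
        - θ.process N Z (t + k * θ.period) ω) P P := by
  have hlaw : ∀ t, P.map (markedFuture N (marks Z) t)
      = (P.map (restart N t)).prod (P.map (marks Z)) := fun t =>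
    hS.poisson.map_markedFuture hS.measurable_marks hS.iIndepFun_marks
      (fun i => hS.law_mark _ _) hS.indepFun_marks t
  have hmeas : ∀ t, Measurable (markedFuture N (marks Z) t) :=
    hS.poisson.measurable_markedFuture hS.measurable_marks
  have hid : IdentDistrib (markedFuture N (marks Z) t)
      (markedFuture N (marks Z) (t + k * θ.period)) P P := by
    refine ⟨(hmeas _).aemeasurable, (hmeas _).aemeasurable, ?_⟩
    rw [hlaw, hlaw, (hS.poisson.identDistrib_restart
      (θ.integral_rate_add_mul_period t k)).map_eq]
  have h := hid.comp (θ.measurable_jumpSum t)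
  have h1 : ∀ t, (fun ω u => θ.process N Z (t + u) ω - θ.process N Z t ω)
      = θ.jumpSum t ∘ markedFuture N (marks Z) t := by
    intro t
    ext ω u
    exact θ.process_sub_eq_jumpSum hS.poisson Z t u ω
  rw [h1, h1, θ.jumpSum_add_mul_period]
  exact h

end Driving

/-! ### Periodicity of the joint law of the observables and the future increments -/

theorem obsEuler_congr {p q : ℕ} (κ : CogarchParam p q) (δ : ℝ) {dx dx' : ℕ → ℝ} (w : ℕ → ℝ)
    {n : ℕ} (h : ∀ i < n, dx i = dx' i) : obsEuler κ δ dx w n = obsEuler κ δ dx' w n := by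
  induction n with
  | zero => rfl
  | succ n ih =>
    simp only [obsEuler]
    rw [ih fun i hi => h i (hi.trans n.lt_succ_self), h n n.lt_succ_self]

/-- The flow over `[0, L]` only depends on the driving path on `[0, L]`. -/
theorem flow_congr {p q : ℕ} (κ : CogarchParam p q) {L : ℝ≥0} (w : ℕ → ℝ) {g g' : ℝ≥0 → ℝ}
    (h : ∀ u ≤ L, g u = g' u) (j : ℕ) : flow κ L w g j = flow κ L w g' j := by
  refine congrArg (limsup · atTop) (funext fun n => ?_)
  have hle : ∀ i ≤ n, L / n * (i : ℝ≥0) ≤ L := by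
    intro i hi
    rcases Nat.eq_zero_or_pos n with rfl | hn
    · simp
    · calc L / n * (i : ℝ≥0) ≤ L / n * n := by gcongr
        _ = L := div_mul_cancel₀ _ (by positivity)
  rw [obsEuler_congr κ _ w fun i hi => ?_]
  rw [h _ (hle _ hi), h _ (hle _ hi.le)]

section StatePeriodicity

variable {Ω : Type*} [MeasurableSpace Ω] {P : Measure Ω} {p q : ℕ} {κ : CogarchParam p q}
  {S : ℝ≥0 → Ω → ℝ} {Y : ℝ≥0 → Ω → Fin q → ℝ}

theorem CogarchParam.IsStateSolution.ae_solvesPathwise (hY : κ.IsStateSolution P S Y) :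
    ∀ᵐ ω ∂P, IsCadlag (fun t => Y t ω) ∧
      SolvesPathwise κ (fun t => S t ω) (fun t => Y t ω) :=
  hY.cadlag.and hY.sde

/-- The volatility, as a random path, is almost everywhere measurable: off a null set it is the
limit of values of `Y` along grids. -/
theorem CogarchParam.IsStateSolution.aemeasurable_volatility (hY : κ.IsStateSolution P S Y)
    (t : ℝ≥0) : AEMeasurable (fun ω u => κ.volatility Y (t + u) ω) P := by
  obtain ⟨A, hA, hAm, hcad⟩ := hY.cadlag.exists_measurable_mem
  refine ⟨fun ω u => A.indicator (κ.volatility Y (t + u)) ω, measurable_pi_lambda _ fun u => ?_, ?_⟩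
  · refine measurable_of_tendsto_metrizable (f := fun n : ℕ => A.indicator fun ω =>
      κ.α 0 + κ.a ⬝ᵥ Y (gridFloor 0 (1 / ((n : ℝ≥0) + 1)) (t + u)) ω) (fun n => ?_)
      (tendsto_pi_nhds.2 fun ω => ?_)
    · have hφ : Measurable fun y : Fin q → ℝ => κ.α 0 + κ.a ⬝ᵥ y :=
        Continuous.measurable (by fun_prop)
      exact (hφ.comp (hY.measurable _)).indicator hAm
    · by_cases hω : ω ∈ A
      · simp only [indicator_of_mem hω]
        have hφ : Continuous fun y : Fin q → ℝ => κ.α 0 + κ.a ⬝ᵥ y := by fun_prop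
        refine (hφ.tendsto _).comp ?_
        rcases eq_or_ne (t + u) 0 with h0 | h0
        · rw [h0, leftLim_eq_of_isBot (fun _ => zero_le)]
          simp [gridFloor]
        · exact ((hcad ω hω).tendsto_leftLim _).comp (tendsto_gridFloor (pos_iff_ne_zero.2 h0)
            (Eventually.of_forall fun n => by positivity) tendsto_one_div_add_atTop_nhds_zero_nat)
      · simp only [indicator_of_notMem hω]
        exact tendsto_const_nhds
  · filter_upwards [hA] with ω hω
    ext u
    rw [indicator_of_mem hω]

/-- Strict periodic stationarity, as equality of the laws of the paths after `t` and after
`t + k τ`. -/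
theorem CogarchParam.IsStateSolution.identDistrib_volatility [IsProbabilityMeasure P]
    (hY : κ.IsStateSolution P S Y) {τ : ℝ≥0}
    (hV : IsStrictlyPeriodicallyStationary P τ (κ.volatility Y)) (t : ℝ≥0) (k : ℕ) :
    IdentDistrib (fun ω u => κ.volatility Y (t + u) ω)
      (fun ω u => κ.volatility Y (t + k * τ + u) ω) P P := by
  have hm := hY.aemeasurable_volatility
  refine (identDistrib_iff_forall_finset_identDistrib (hm t) (hm _)).2 fun I => ?_
  have h1 : AEMeasurable (fun ω => I.restrict fun u => κ.volatility Y (t + u) ω) P :=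
    (Finset.measurable_restrict I).comp_aemeasurable (hm t)
  have h2 : AEMeasurable (fun ω => I.restrict fun u => κ.volatility Y (t + k * τ + u) ω) P :=
    (Finset.measurable_restrict I).comp_aemeasurable (hm (t + k * τ))
  refine ⟨h1, h2, ?_⟩
  have := Measure.isProbabilityMeasure_map (μ := P) h1
  refine ext_of_generate_finite _ generateFrom_pi.symm isPiSystem_pi ?_ ?_
  · rintro _ ⟨J, hJ, rfl⟩
    have hJ : ∀ i, MeasurableSet (J i) := fun i => hJ i (mem_univ i)
    have hpi : MeasurableSet (univ.pi J) := MeasurableSet.univ_pi hJ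
    rw [Measure.map_apply_of_aemeasurable h1 hpi, Measure.map_apply_of_aemeasurable h2 hpi]
    have h := hV I.card (fun m => t + (I.equivFin.symm m : ℝ≥0)) (fun m => J (I.equivFin.symm m))
      (fun m => hJ _) k
    convert h using 2
    · ext ω
      simp only [mem_preimage, mem_univ_pi, mem_ofPred_eq]
      exact (I.equivFin.symm.forall_congr_right (q := fun i : I =>
        κ.volatility Y (t + (i : ℝ≥0)) ω ∈ J i)).symm
    · ext ω
      simp only [mem_preimage, mem_univ_pi, mem_ofPred_eq, add_right_comm t _ (k * τ)]
      exact (I.equivFin.symm.forall_congr_right (q := fun i : I =>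
        κ.volatility Y (t + k * τ + (i : ℝ≥0)) ω ∈ J i)).symm
  · rw [measure_univ, (Measure.isProbabilityMeasure_map h2).measure_univ]

end StatePeriodicity

section Joint

variable {Ω : Type*} [MeasurableSpace Ω] {P : Measure Ω} {θ : SemiLevyData} {N : ℝ≥0 → Ω → ℕ}
  {Z : ℕ+ → Fin θ.l → Ω → ℝ} {p q : ℕ} {κ : CogarchParam p q} {Y : ℝ≥0 → Ω → Fin q → ℝ}

/-- The observables of the state at time `t` are a functional of the volatility just after `t`. -/
theorem SemiLevyData.IsSource.ae_germ_eq_obs (hS : θ.IsSource P N Z)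
    (hY : κ.IsStateSolution P (θ.process N Z) Y) (t : ℝ≥0) :
    (fun ω j => germ (κ.α 0) (fun u => κ.volatility Y (t + u) ω) j 0)
      =ᵐ[P] fun ω j => obs κ j (Y t ω) := by
  filter_upwards [hY.ae_solvesPathwise] with ω hω
  obtain ⟨ε, hε, hc⟩ := θ.exists_continuousOn_process hS.poisson Z ω t
  ext j
  have h := hω.2.germ_volatility (θ.isFV_process hS.poisson Z ω) hω.1 hc j 0 hε
  rw [add_zero] at h
  exact h

theorem SemiLevyData.IsSource.identDistrib_obs [IsProbabilityMeasure P] (hS : θ.IsSource P N Z)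
    (hY : κ.IsStateSolution P (θ.process N Z) Y)
    (hV : IsStrictlyPeriodicallyStationary P θ.period (κ.volatility Y)) (t : ℝ≥0) (k : ℕ) :
    IdentDistrib (fun ω j => obs κ j (Y t ω))
      (fun ω j => obs κ j (Y (t + k * θ.period) ω)) P P := by
  have hm : Measurable fun (v : ℝ≥0 → ℝ) (j : ℕ) => germ (κ.α 0) v j 0 :=
    measurable_pi_lambda _ fun j => measurable_germ _ j 0
  have h := (hY.identDistrib_volatility hV t k).comp hm
  exact (IdentDistrib.of_ae_eq h.aemeasurable_fst (hS.ae_germ_eq_obs hY t)).symm.trans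
    (h.trans (IdentDistrib.of_ae_eq h.aemeasurable_snd (hS.ae_germ_eq_obs hY _)))

/-- The observables at time `t` are determined by the initial state and by the increments of the
driving process up to `t`, hence are independent of the increments after `t`. -/
theorem SemiLevyData.IsSource.indepFun_obs_future [IsProbabilityMeasure P]
    (hS : θ.IsSource P N Z) (hY : κ.IsStateSolution P (θ.process N Z) Y) (t : ℝ≥0) :
    IndepFun (fun ω j => obs κ j (Y t ω))
      (fun ω u => θ.process N Z (t + u) ω - θ.process N Z t ω) P := by
  have hobs : Measurable fun (y : Fin q → ℝ) (j : ℕ) => obs κ j y :=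
    measurable_pi_lambda _ fun j => (continuous_obs κ j).measurable
  have hincr : Measurable fun (x : ℝ≥0 → ℝ) =>
      ((fun u => x (min u t) - x 0 : ℝ≥0 → ℝ), (fun u => x (t + u) - x t : ℝ≥0 → ℝ)) :=
    Measurable.prodMk (by fun_prop) (by fun_prop)
  have hpast : Measurable fun ω u => θ.process N Z (min u t) ω - θ.process N Z 0 ω := by
    have h := hS.measurable_futureIncrements 0
    refine measurable_pi_lambda _ fun u => ?_
    simpa only [zero_add, Function.comp_def] using (measurable_pi_apply (min u t)).comp h
  -- Pair the initial observables with the past, and a constant with the future.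
  have h := indepFun_prodMk_prodMk_of_indepFun (P := P) (b := fun _ => (0 : ℝ))
    (mβ := inferInstance)
    (hobs.comp (hY.measurable 0)) measurable_const hpast (hS.measurable_futureIncrements t)
    (indepFun_const_right _ _) (hS.indepFun_past_future t)
    ((hY.indep_initial.comp hobs hincr).comp
      (measurable_id.prodMk measurable_const) measurable_id)
  have hflow : Measurable fun (z : (ℕ → ℝ) × (ℝ≥0 → ℝ)) (j : ℕ) => flow κ t z.1 z.2 j :=
    measurable_pi_lambda _ fun j => measurable_flow κ t j
  refine (h.comp hflow measurable_snd).congr ?_ (ae_of_all _ fun _ => rfl)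
  filter_upwards [hY.ae_solvesPathwise] with ω hω
  ext j
  have h := hω.2.obs_eq_flow (θ.isFV_process hS.poisson Z ω) hω.1 0 t j
  rw [zero_add] at h
  rw [h]
  refine flow_congr κ _ (fun u hu => ?_) j
  change θ.process N Z (min u t) ω - _ = θ.process N Z (0 + u) ω - _
  rw [zero_add, min_eq_left hu]

/-- The joint law of two increments of the integrated process is periodic: both are functionals of
the observables at time `t` and the increments of the driving process after `t`, which are
independent with periodic laws. -/
theorem SemiLevyData.IsSource.identDistrib_increment_prodMk [IsProbabilityMeasure P]
    (hS : θ.IsSource P N Z) (hY : κ.IsStateSolution P (θ.process N Z) Y)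
    (hV : IsStrictlyPeriodicallyStationary P θ.period (κ.volatility Y)) (r t h : ℝ≥0) (k : ℕ) :
    IdentDistrib
      (fun ω => (increment (κ.volatility Y) (θ.process N Z) r t ω,
        increment (κ.volatility Y) (θ.process N Z) r (t + h) ω))
      (fun ω => (increment (κ.volatility Y) (θ.process N Z) r (t + k * θ.period) ω,
        increment (κ.volatility Y) (θ.process N Z) r (t + h + k * θ.period) ω)) P P := by
  have hlaw := ((hS.identDistrib_obs hY hV t k).prodMk (hS.identDistrib_future t k)
    (hS.indepFun_obs_future hY t) (hS.indepFun_obs_future hY _)).comp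
    ((measurable_incrementFunctional κ r 0).prodMk (measurable_incrementFunctional κ r h))
  have hae : ∀ t, (fun z => (incrementFunctional κ r 0 z, incrementFunctional κ r h z)) ∘
        (fun ω => ((fun j => obs κ j (Y t ω)),
          fun u => θ.process N Z (t + u) ω - θ.process N Z t ω))
      =ᵐ[P] fun ω => (increment (κ.volatility Y) (θ.process N Z) r t ω,
        increment (κ.volatility Y) (θ.process N Z) r (t + h) ω) := by
    intro t
    filter_upwards [hY.ae_solvesPathwise] with ω hω
    have h0 := hω.2.increment_eq (θ.isFV_process hS.poisson Z ω) hω.1 r t 0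
    have hh := hω.2.increment_eq (θ.isFV_process hS.poisson Z ω) hω.1 r t h
    rw [add_zero] at h0
    exact Prod.ext h0.symm hh.symm
  rw [add_right_comm t h]
  exact (IdentDistrib.of_ae_eq hlaw.aemeasurable_fst (hae t)).symm.trans
    (hlaw.trans (IdentDistrib.of_ae_eq hlaw.aemeasurable_snd (hae _)))

end Joint

theorem _root_.ProbabilityTheory.IdentDistrib.covariance_eq {Ω Ω' : Type*} [MeasurableSpace Ω]
    [MeasurableSpace Ω'] {μ : Measure Ω} {ν : Measure Ω'} {X X' : Ω → ℝ} {W W' : Ω' → ℝ}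
    (h : IdentDistrib (fun ω => (X ω, X' ω)) (fun ω => (W ω, W' ω)) μ ν) :
    covariance X X' μ = covariance W W' ν := by
  have h1 : ∫ ω, X ω ∂μ = ∫ ω, W ω ∂ν := (h.comp measurable_fst).integral_eq
  have h2 : ∫ ω, X' ω ∂μ = ∫ ω, W' ω ∂ν := (h.comp measurable_snd).integral_eq
  rw [covariance, covariance, h1, h2]
  exact (h.comp (u := fun z : ℝ × ℝ => (z.1 - ∫ ω, W ω ∂ν) * (z.2 - ∫ ω, W' ω ∂ν))
    (by fun_prop)).integral_eq

end

end SSCOGARCH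

theorem corollary3p2 {Ω : Type*} [MeasurableSpace Ω] (P : Measure Ω) [IsProbabilityMeasure P]
    (θ : SSCOGARCH.SemiLevyData) (N : ℝ≥0 → Ω → ℕ) (Z : ℕ+ → Fin θ.l → Ω → ℝ)
    (hS : θ.IsSource P N Z)
    {p q : ℕ} (κ : SSCOGARCH.CogarchParam p q) (Y : ℝ≥0 → Ω → Fin q → ℝ)
    (hY : κ.IsStateSolution P (θ.process N Z) Y)
    (hV : SSCOGARCH.IsStrictlyPeriodicallyStationary P θ.period (κ.volatility Y))
    (r : ℝ≥0) (hr : 0 < r)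
    (G : ℝ≥0 → Ω → ℝ)
    (hG : G = SSCOGARCH.increment (κ.volatility Y) (θ.process N Z) r) :
    (∀ (t : ℝ≥0) (k : ℕ),
      (Integrable (G t) P ↔ Integrable (G (t + k * θ.period)) P) ∧
      (MemLp (G t) 2 P ↔ MemLp (G (t + k * θ.period)) 2 P) ∧
      ∫ ω, G t ω ∂P = ∫ ω, G (t + k * θ.period) ω ∂P) ∧
    (∀ (t h : ℝ≥0) (k : ℕ),
      (Integrable (fun ω => G t ω * G (t + h) ω) P ↔
        Integrable (fun ω => G (t + k * θ.period) ω * G (t + h + k * θ.period) ω) P) ∧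
      covariance (G t) (G (t + h)) P =
        covariance (G (t + k * θ.period)) (G (t + h + k * θ.period)) P) ∧
    ((∀ t, MemLp (G t) 2 P) → SSCOGARCH.IsPeriodicallyCorrelated P θ.period G) := by
  subst hG
  have hlaw := hS.identDistrib_increment_prodMk hY hV r
  have hmean : ∀ (t : ℝ≥0) (k : ℕ), IdentDistrib
      (SSCOGARCH.increment (κ.volatility Y) (θ.process N Z) r t)
      (SSCOGARCH.increment (κ.volatility Y) (θ.process N Z) r (t + k * θ.period)) P P :=
    fun t k => (hlaw t 0 k).comp measurable_fst
  refine ⟨fun t k => ⟨(hmean t k).integrable_iff, (hmean t k).memLp_iff, (hmean t k).integral_eq⟩,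
    fun t h k => ⟨?_, (hlaw t h k).covariance_eq⟩, fun hL2 => ⟨hL2, fun t k =>
      (hmean t k).integral_eq, fun t h k => (hlaw t h k).covariance_eq⟩⟩
  exact ((hlaw t h k).comp (u := fun z : ℝ × ℝ => z.1 * z.2) (by fun_prop)).integrable_iff
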